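/- Let $K$ be a field and let $Q$ be a quiver (a finite directed graph, loops and parallel arrows allowed), with arrows $a\colon ta\to ha$. Let $\alpha,\beta$ be dimension vectors for $Q$. Let $L\supseteq K$ be any extension field ($L=K$ is allowed); all varieties below are defined over $K$, points are $L$-points, and topologies are Zariski topologies with respect to $K$ (closed sets are cut out by polynomials with coefficients in $K$; for $L=K$ this is the usual Zariski topology on $K$-points). Let $\mathrm{rep}(\alpha)=\bigoplus_a \mathrm{Hom}(L^{\alpha(ta)},L^{\alpha(ha)})$, let $\mathrm{Gr}\binom{\alpha}{\beta}=\prod_x \mathrm{Gr}\binom{\alpha(x)}{\beta(x)}$ be the product over the vertices $x$ of the Grassmannians of $\beta(x)$-dimensional subspaces of $L^{\alpha(x)}$, and let $$\mathrm{rep}\tbinom{\alpha}{\beta}=\{(W,\phi)\in \mathrm{Gr}\tbinom{\alpha}{\beta}\times \mathrm{rep}(\alpha) : \phi_a(W_{ta})\subseteq W_{ha}\text{ for all arrows }a\}$$ be Schofield's bundle of $\beta$-dimensional subrepresentations. A point $(W,\phi)$ gives the subrepresentation $\phi|_W$ and the quotient representation $\phi/\phi|_W$ of $Q$. For a finite-dimensional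 representation $\phi$ of a connected quiver, the global rank of $\phi$ is the common dimension, at all vertices, of the image of the composition $E(\phi)\hookrightarrow\phi\twoheadrightarrow I(\phi)$, where $E(\phi)$ is the largest subrepresentation of $\phi$ in which all arrows act surjectively and $I(\phi)$ is the largest quotient of $\phi$ in which all arrows act injectively. For a morphism of quivers $f\colon Q'\to Q''$ the pullback of a representation is $f^*(W_x,\psi_a)=(W_{f(x)},\psi_{f(a)})$ and the pushforward is $f_*(V_y,\phi_b)=\left(\bigoplus_{y\in f^{-1}(x)}V_y,\ \sum_{b\in f^{-1}(a)}\phi_b\right)$. A rank function on $Q$ is a function of representations of $Q$ obtained by applying a finite (possibly empty) sequence of pullbacks and pushforwards along quiver morphisms, starting at $Q$ and ending at a connected quiver, followed by the global rank of that last quiver. A rank locus in $\mathrm{rep}\binom{\alpha}{\beta}$ is the set of points $(W,\phi)$ that satisfy a finite list of linear inequalities (weak or strict, with real coefficients and constant terms) among values $r(\phi|_W)$ and $r'(\phi/\phi|_W)$ of finitely many rank functions $r,r'$ on $Q$. **Theorem.** Every rank locus in $\mathrm{rep}\binom{\alpha}{\beta}$ is constructible, that is, it is obtained from finitely many open or closed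 subsets of $\mathrm{rep}\binom{\alpha}{\beta}$ by unions and intersections. -/

import Mathlib

universe u v

/-- A quiver: a finite directed graph, loops and parallel arrows allowed.  The arrow `a` goes from
`tail a` to `head a`. -/
structure FinQuiver where
  Vertex : Type
  Arrow : Type
  [fintypeVertex : Fintype Vertex]
  [decEqVertex : DecidableEq Vertex]
  [fintypeArrow : Fintype Arrow]
  [decEqArrow : DecidableEq Arrow]
  tail : Arrow → Vertex
  head : Arrow → Vertex

attribute [instance] FinQuiver.fintypeVertex FinQuiver.decEqVertex FinQuiver.fintypeArrow
  FinQuiver.decEqArrow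

/-- The underlying undirected graph is connected (in particular it has a vertex). -/
def FinQuiver.IsConnected (Q : FinQuiver) : Prop :=
  Nonempty Q.Vertex ∧
    ∀ x y : Q.Vertex, Relation.EqvGen (fun x y => ∃ a, Q.tail a = x ∧ Q.head a = y) x y

/-- A morphism of quivers. -/
structure FinQuiver.Hom (Q' Q : FinQuiver) where
  onVertex : Q'.Vertex → Q.Vertex
  onArrow : Q'.Arrow → Q.Arrow
  tail_eq : ∀ b, Q.tail (onArrow b) = onVertex (Q'.tail b)
  head_eq : ∀ b, Q.head (onArrow b) = onVertex (Q'.head b)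

/-- A finite-dimensional representation of the quiver `Q` over the field `L`. -/
structure QuiverRep (L : Type v) [Field L] (Q : FinQuiver) where
  space : Q.Vertex → Type v
  [addCommGroup : ∀ x, AddCommGroup (space x)]
  [module : ∀ x, Module L (space x)]
  [finite : ∀ x, Module.Finite L (space x)]
  map : ∀ a : Q.Arrow, space (Q.tail a) →ₗ[L] space (Q.head a)

attribute [instance] QuiverRep.addCommGroup QuiverRep.module QuiverRep.finite

namespace QuiverRep

variable {L : Type v} [Field L] {Q Q' : FinQuiver}

/-- A family of subspaces preserved by all the maps of the representation. -/
def IsSubrep (φ : QuiverRep L Q) (W : ∀ x, Submodule L (φ.space x)) : Prop :=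
  ∀ a, ∀ v ∈ W (Q.tail a), φ.map a v ∈ W (Q.head a)

/-- The subrepresentation on a stable family of subspaces. -/
def sub (φ : QuiverRep L Q) (W : ∀ x, Submodule L (φ.space x)) (hW : φ.IsSubrep W) :
    QuiverRep L Q where
  space x := W x
  map a := (φ.map a).restrict (hW a)

/-- The quotient representation by a stable family of subspaces. -/
def quot (φ : QuiverRep L Q) (W : ∀ x, Submodule L (φ.space x)) (hW : φ.IsSubrep W) :
    QuiverRep L Q where
  space x := φ.space x ⧸ W x
  map a := (W (Q.tail a)).mapQ (W (Q.head a)) (φ.map a) (hW a)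

/-- Every map of the representation is surjective. -/
def IsEpimorphic (φ : QuiverRep L Q) : Prop := ∀ a, Function.Surjective (φ.map a)

/-- Every map of the representation is injective. -/
def IsMonomorphic (φ : QuiverRep L Q) : Prop := ∀ a, Function.Injective (φ.map a)

/-- The largest subrepresentation in which every arrow acts surjectively
(see `isGreatest_epiPart`). -/
def epiPart (φ : QuiverRep L Q) : ∀ x, Submodule L (φ.space x) :=
  sSup {W | ∃ hW : φ.IsSubrep W, (φ.sub W hW).IsEpimorphic}

/-- The kernel of the projection of `φ` onto its largest quotient in which every arrow acts
injectively: the smallest subrepresentation whose quotient has this property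
(see `isLeast_monoKer`). -/
def monoKer (φ : QuiverRep L Q) : ∀ x, Submodule L (φ.space x) :=
  sInf {N | ∃ hN : φ.IsSubrep N, (φ.quot N hN).IsMonomorphic}

/-- The space at the vertex `x` of the image of the composition of the inclusion of the largest
epimorphic subrepresentation with the projection onto the largest monomorphic quotient. -/
def rankSpace (φ : QuiverRep L Q) (x : Q.Vertex) : Submodule L (φ.space x ⧸ φ.monoKer x) :=
  (φ.epiPart x).map (φ.monoKer x).mkQ

lemma epi_iff (φ : QuiverRep L Q) (W : ∀ x, Submodule L (φ.space x)) :
    (∃ hW : φ.IsSubrep W, (φ.sub W hW).IsEpimorphic) ↔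
      ∀ a, (W (Q.tail a)).map (φ.map a) = W (Q.head a) := by
  constructor
  · rintro ⟨hW, he⟩ a
    apply le_antisymm
    · rintro _ ⟨v, hv, rfl⟩
      exact hW a v hv
    · intro w hw
      obtain ⟨⟨v, hv⟩, h⟩ := he a ⟨w, hw⟩
      exact ⟨v, hv, congrArg Subtype.val h⟩
  · intro h
    refine ⟨fun a v hv => h a ▸ Submodule.mem_map_of_mem hv, ?_⟩
    rintro a ⟨w, hw⟩
    have hw' : w ∈ (W (Q.tail a)).map (φ.map a) := by rw [h a]; exact hw
    obtain ⟨v, hv, rfl⟩ := hw'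
    exact ⟨⟨v, hv⟩, rfl⟩

lemma mono_iff (φ : QuiverRep L Q) (N : ∀ x, Submodule L (φ.space x)) :
    (∃ hN : φ.IsSubrep N, (φ.quot N hN).IsMonomorphic) ↔
      ∀ a, (N (Q.head a)).comap (φ.map a) = N (Q.tail a) := by
  constructor
  · rintro ⟨hN, hm⟩ a
    apply le_antisymm
    · intro v hv
      have h0 : (φ.quot N hN).map a ((N (Q.tail a)).mkQ v) = (φ.quot N hN).map a 0 := by
        rw [map_zero]
        exact (Submodule.Quotient.mk_eq_zero _).2 hv
      exact (Submodule.Quotient.mk_eq_zero _).1 (hm a h0)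
    · exact hN a
  · intro h
    refine ⟨fun a v hv => ?_, fun a => ?_⟩
    · rw [← h a] at hv
      exact hv
    · refine (injective_iff_map_eq_zero ((φ.quot N _).map a)).2 ?_
      intro y hy
      obtain ⟨v, rfl⟩ := Submodule.mkQ_surjective (N (Q.tail a)) y
      have hv : φ.map a v ∈ N (Q.head a) := (Submodule.Quotient.mk_eq_zero _).1 hy
      exact (Submodule.Quotient.mk_eq_zero _).2 (by rw [← h a]; exact hv)

lemma isGreatest_epiPart (φ : QuiverRep L Q) :
    IsGreatest {W | ∃ hW : φ.IsSubrep W, (φ.sub W hW).IsEpimorphic} φ.epiPart := by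
  refine ⟨(φ.epi_iff _).2 fun a => ?_, fun W hW => le_sSup hW⟩
  simp only [epiPart, sSup_apply, Submodule.map_iSup]
  exact iSup_congr fun W => (φ.epi_iff W.1).1 W.2 a

lemma isLeast_monoKer (φ : QuiverRep L Q) :
    IsLeast {N | ∃ hN : φ.IsSubrep N, (φ.quot N hN).IsMonomorphic} φ.monoKer := by
  refine ⟨(φ.mono_iff _).2 fun a => ?_, fun N hN => sInf_le hN⟩
  simp only [monoKer, sInf_apply, Submodule.comap_iInf]
  exact iInf_congr fun N => (φ.mono_iff N.1).1 N.2 a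

lemma finrank_rankSpace_arrow (φ : QuiverRep L Q) (a : Q.Arrow) :
    Module.finrank L (φ.rankSpace (Q.tail a)) = Module.finrank L (φ.rankSpace (Q.head a)) := by
  obtain ⟨hN, hm⟩ := φ.isLeast_monoKer.1
  have he := (φ.epi_iff _).1 φ.isGreatest_epiPart.1 a
  let g : (φ.space (Q.tail a) ⧸ φ.monoKer (Q.tail a)) →ₗ[L]
      (φ.space (Q.head a) ⧸ φ.monoKer (Q.head a)) :=
    (φ.monoKer (Q.tail a)).mapQ (φ.monoKer (Q.head a)) (φ.map a) (hN a)
  have hg : Function.Injective g := hm a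
  have key : (φ.rankSpace (Q.tail a)).map g = φ.rankSpace (Q.head a) := by
    unfold rankSpace
    rw [← he, ← Submodule.map_comp, ← Submodule.map_comp]
    rfl
  rw [← key]
  exact (Submodule.equivMapOfInjective g hg _).finrank_eq

lemma finrank_rankSpace_eq (hQ : Q.IsConnected) (φ : QuiverRep L Q) (x y : Q.Vertex) :
    Module.finrank L (φ.rankSpace x) = Module.finrank L (φ.rankSpace y) := by
  induction hQ.2 x y with
  | rel x y h => obtain ⟨a, rfl, rfl⟩ := h; exact φ.finrank_rankSpace_arrow a
  | refl x => rfl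
  | symm x y _ ih => exact ih.symm
  | trans x y z _ _ ih₁ ih₂ => exact ih₁.trans ih₂

/-- The global rank function of a connected quiver: the common dimension of the spaces
`φ.rankSpace x` (by `finrank_rankSpace_eq`, the vertex does not matter). -/
noncomputable def globalRank (hQ : Q.IsConnected) (φ : QuiverRep L Q) : ℕ :=
  Module.finrank L (φ.rankSpace hQ.1.some)

/-- The pullback of a representation of `Q` along `f : Q' → Q`. -/
def pullback (f : FinQuiver.Hom Q' Q) (ψ : QuiverRep L Q) : QuiverRep L Q' where
  space x := ψ.space (f.onVertex x)
  map b := (LinearEquiv.cast (R := L) (M := ψ.space) (f.head_eq b)).toLinearMap ∘ₗ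
    ψ.map (f.onArrow b) ∘ₗ
      (LinearEquiv.cast (R := L) (M := ψ.space) (f.tail_eq b).symm).toLinearMap

/-- The pushforward of a representation of `Q'` along `f : Q' → Q`: at the vertex `x` it is the
direct sum of the spaces over `f⁻¹(x)`, and the arrow `a` acts by the sum of the maps of the arrows
in `f⁻¹(a)`, each extended by zero. -/
def pushforward (f : FinQuiver.Hom Q' Q) (φ : QuiverRep L Q') : QuiverRep L Q where
  space x := ∀ y : {y : Q'.Vertex // f.onVertex y = x}, φ.space y
  map a := ∑ b : {b : Q'.Arrow // f.onArrow b = a},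
    LinearMap.single L (fun y : {y // f.onVertex y = Q.head a} => φ.space y)
        ⟨Q'.head b, by rw [← f.head_eq, b.2]⟩ ∘ₗ
      φ.map b ∘ₗ
        LinearMap.proj (φ := fun y : {y // f.onVertex y = Q.tail a} => φ.space y)
          ⟨Q'.tail b, by rw [← f.tail_eq, b.2]⟩

end QuiverRep

/-- The (additive) rank functions on a quiver: those obtained by applying a finite chain of
pullbacks and pushforwards along morphisms of quivers, followed by the global rank function of the
last quiver of the chain. -/
inductive IsRankFunction (L : Type v) [Field L] : ∀ Q : FinQuiver, (QuiverRep L Q → ℕ) → Prop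
  | globalRank (Q : FinQuiver) (hQ : Q.IsConnected) :
      IsRankFunction L Q (QuiverRep.globalRank hQ)
  | pullback (Q Q' : FinQuiver) (f : FinQuiver.Hom Q' Q) (r : QuiverRep L Q' → ℕ)
      (hr : IsRankFunction L Q' r) : IsRankFunction L Q fun ψ => r (ψ.pullback f)
  | pushforward (Q Q' : FinQuiver) (f : FinQuiver.Hom Q Q') (r : QuiverRep L Q' → ℕ)
      (hr : IsRankFunction L Q' r) : IsRankFunction L Q fun φ => r (φ.pushforward f)

/-- The representation space of dimension vector `α`. -/
def RepSpace (L : Type v) [Field L] (Q : FinQuiver) (α : Q.Vertex → ℕ) : Type v :=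
  ∀ a : Q.Arrow, (Fin (α (Q.tail a)) → L) →ₗ[L] (Fin (α (Q.head a)) → L)

/-- A point of the representation space, seen as a representation. -/
def RepSpace.toRep {L : Type v} [Field L] {Q : FinQuiver} {α : Q.Vertex → ℕ}
    (φ : RepSpace L Q α) : QuiverRep L Q where
  space x := Fin (α x) → L
  map := φ

/-- The product over the vertices `x` of the Grassmannians of `β x`-dimensional subspaces of
`L ^ α x`. -/
def Gr (L : Type v) [Field L] (Q : FinQuiver) (α β : Q.Vertex → ℕ) : Type v :=
  ∀ x, {W : Submodule L (Fin (α x) → L) // Module.finrank L W = β x}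

/-- The bundle of `β`-dimensional subrepresentations on the representation space: the pairs
`(W, φ)` with `φ a (W (tail a)) ⊆ W (head a)` for all arrows `a`. -/
def SubrepBundle (L : Type v) [Field L] (Q : FinQuiver) (α β : Q.Vertex → ℕ) : Type v :=
  {p : Gr L Q α β × RepSpace L Q α // p.2.toRep.IsSubrep fun x => (p.1 x).1}

namespace SubrepBundle

variable {L : Type v} [Field L] {Q : FinQuiver} {α β : Q.Vertex → ℕ}

/-- The representation `φ|_W` given by a point `(W, φ)` of the bundle. -/
def subRep (p : SubrepBundle L Q α β) : QuiverRep L Q := p.1.2.toRep.sub _ p.2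

/-- The quotient of `φ` by `φ|_W` given by a point `(W, φ)` of the bundle. -/
def quotRep (p : SubrepBundle L Q α β) : QuiverRep L Q := p.1.2.toRep.quot _ p.2

/-- The functions on the bundle induced by rank functions, applied to the subrepresentation or to
the quotient representation. -/
def IsInducedRankFunction (s : SubrepBundle L Q α β → ℕ) : Prop :=
  ∃ r, IsRankFunction L Q r ∧ ((s = fun p => r p.subRep) ∨ (s = fun p => r p.quotRep))

/-- Rank loci in the bundle: the solution sets of finitely many linear inequalities, weak or
strict, in the values of finitely many induced rank functions. -/
def IsRankLocus (S : Set (SubrepBundle L Q α β)) : Prop :=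
  ∃ (n m m' : ℕ) (s : Fin n → SubrepBundle L Q α β → ℕ)
    (A : Matrix (Fin m) (Fin n) ℝ) (b : Fin m → ℝ)
    (A' : Matrix (Fin m') (Fin n) ℝ) (b' : Fin m' → ℝ),
    (∀ i, IsInducedRankFunction (s i)) ∧
      S = {p | (∀ j, ∑ i, A j i * (s i p : ℝ) ≤ b j) ∧ ∀ j, ∑ i, A' j i * (s i p : ℝ) < b' j}

end SubrepBundle

/-- The Zariski topology, with respect to the ground field `K`, on the `L`-points of affine space:
the closed sets are the zero loci of sets of polynomials with coefficients in `K`. -/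
noncomputable abbrev zariskiTopology (K : Type u) (L : Type v) [Field K] [Field L] [Algebra K L]
    (ι : Type) : TopologicalSpace (ι → L) :=
  TopologicalSpace.ofClosed
    {Z | ∃ P : Set (MvPolynomial ι K), Z = {x | ∀ p ∈ P, MvPolynomial.aeval x p = 0}}
    ⟨{1}, by ext x; simp⟩
    (by
      intro 𝒜 h𝒜
      refine ⟨{p | ∃ Z ∈ 𝒜, ∀ x ∈ Z, MvPolynomial.aeval x p = 0}, ?_⟩
      ext x
      constructor
      · rintro hx p ⟨Z, hZ, hp⟩
        exact hp x (hx Z hZ)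
      · intro hx Z hZ
        obtain ⟨P, hP⟩ := h𝒜 hZ
        rw [hP]
        refine fun p hp => hx p ⟨Z, hZ, fun y hy => ?_⟩
        rw [hP] at hy
        exact hy p hp)
    (by
      rintro _ ⟨P, rfl⟩ _ ⟨P', rfl⟩
      refine ⟨{r | ∃ p ∈ P, ∃ q ∈ P', r = p * q}, ?_⟩
      ext x
      constructor
      · rintro (hx | hx) _ ⟨p, hp, q, hq, rfl⟩
        · rw [map_mul, hx p hp, zero_mul]
        · rw [map_mul, hx q hq, mul_zero]
      · intro hx
        by_contra hn
        simp only [Set.mem_union, Set.mem_ofPred_eq, not_or, not_forall] at hn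
        obtain ⟨⟨p, hp, hp0⟩, ⟨q, hq, hq0⟩⟩ := hn
        have := hx (p * q) ⟨p, hp, q, hq, rfl⟩
        rw [map_mul] at this
        exact (mul_eq_zero.1 this).elim hp0 hq0)

/-- Coordinates for a choice of `α x × β x` matrices at the vertices `x` together with a point of
the representation space, given by `α (head a) × α (tail a)` matrices at the arrows `a`. -/
abbrev FrameCoord (Q : FinQuiver) (α β : Q.Vertex → ℕ) : Type :=
  (Σ x : Q.Vertex, Fin (α x) × Fin (β x)) ⊕
    (Σ a : Q.Arrow, Fin (α (Q.head a)) × Fin (α (Q.tail a)))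

/-- The columns at `x` of a point of the coordinate space. -/
def frame {L : Type v} {Q : FinQuiver} {α β : Q.Vertex → ℕ}
    (c : FrameCoord Q α β → L) (x : Q.Vertex) (j : Fin (β x)) : Fin (α x) → L :=
  fun i => c (Sum.inl ⟨x, i, j⟩)

/-- The open subset of affine space where the columns at every vertex `x` are linearly
independent, that is, form a frame of a `β x`-dimensional subspace of `L ^ α x`. -/
def FramedRep (L : Type v) [Field L] (Q : FinQuiver) (α β : Q.Vertex → ℕ) : Type v :=
  {c : FrameCoord Q α β → L // ∀ x, LinearIndependent L (frame c x)}

/-- The map sending frames of subspaces and a representation to the subspaces and the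
representation. -/
noncomputable def FramedRep.toGrRep {L : Type v} [Field L] {Q : FinQuiver} {α β : Q.Vertex → ℕ}
    (c : FramedRep L Q α β) : Gr L Q α β × RepSpace L Q α :=
  (fun x => ⟨Submodule.span L (Set.range (frame c.1 x)), by
      simpa using finrank_span_eq_card (c.2 x)⟩,
    fun a => Matrix.toLin' (Matrix.of fun i j => c.1 (Sum.inr ⟨a, i, j⟩)))

/-- The Zariski topology (with respect to `K`) on the `L`-points of the product variety
`Gr × rep(α)`.  A product of Grassmannians is the quotient of the variety of tuples of frames by a
product of general linear groups, and the quotient map has regular sections, defined over the prime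
field, on the standard affine charts.  So a subset is closed exactly when its preimage in the
variety of frames and representations, an open subset of an affine space, is closed. -/
noncomputable abbrev grRepTopology (K : Type u) (L : Type v) [Field K] [Field L] [Algebra K L] (Q : FinQuiver)
    (α β : Q.Vertex → ℕ) : TopologicalSpace (Gr L Q α β × RepSpace L Q α) :=
  TopologicalSpace.coinduced FramedRep.toGrRep
    (TopologicalSpace.induced Subtype.val (zariskiTopology K L (FrameCoord Q α β)))

/-- The Zariski topology (with respect to `K`) on the `L`-points of the bundle of subrepresentations,
as a subvariety of `Gr × rep(α)`. -/
noncomputable abbrev SubrepBundle.zariski (K : Type u) (L : Type v) [Field K] [Field L] [Algebra K L]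
    (Q : FinQuiver) (α β : Q.Vertex → ℕ) : TopologicalSpace (SubrepBundle L Q α β) :=
  TopologicalSpace.induced Subtype.val (grRepTopology K L Q α β)

/-! The largest epimorphic subrepresentation is the limit of a descending iteration: start from all
of `φ` and repeatedly intersect with images and preimages along arrows. The kernel of the largest
monomorphic quotient is the limit of the dual ascending iteration. The total dimension bounds the
number of steps (`epiPart_eq_iterate`, `monoKer_eq_iterate`), so for a family of bounded dimension
both are given by one formula, valid at all points of the family.

This formula is positive primitive: it asserts that a linear system is solvable, with coefficients
in a ring `A` of functions of the point. The subspace it defines is a projection of the kernel of a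
matrix, so its dimension is a combination of ranks of matrices over `A`
(`IsPrimitive.finitelyMeasurable_finrank`). Ranks are decided by the vanishing of minors, which lie
in `A`. Quantifiers are thus eliminated by linear algebra alone, and no algebraic closedness is
needed.

Spaces of subrepresentations and quotients come as images of coordinate spaces, and a `Presentation`
records the kernels and the graphs of the arrows by such formulas. It is inherited by pullbacks and
pushforwards, so every rank function takes finitely many values with fibres in the Boolean algebra
generated by zero sets of `A` (`IsRankFunction.finitelyMeasurable`). Any condition on finitely many
such functions, linear or not, then defines a set of that algebra.

Finally the bundle is covered by the finitely many standard charts of the Grassmannians. There the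
subspaces have unique normal frames whose entries, by Cramer's rule, are quotients of polynomials in
an arbitrary frame (`normalFrame_mem_chartRing`). Zero sets of such functions are closed in the
chart (`isClosed_setOf_mem_chart_imp`), so `A` can be taken to be the ring of these functions. -/

section Definability

variable {X : Type*} {L : Type v} [Field L]

/-! ### Functions with finitely many values and fibres in a Boolean algebra of sets -/

lemma BooleanSubalgebra.biUnion_mem {C : BooleanSubalgebra (Set X)} {ι : Type*} {t : Set ι}
    (ht : t.Finite) {f : ι → Set X} (hf : ∀ i ∈ t, f i ∈ C) : (⋃ i ∈ t, f i) ∈ C := by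
  induction t, ht using Set.Finite.induction_on with
  | empty => simpa using C.bot_mem
  | @insert a s _ _ ih =>
    rw [Set.biUnion_insert]
    exact C.supClosed (hf a (by simp)) (ih fun i hi => hf i (by simp [hi]))

lemma BooleanSubalgebra.iUnion_mem {C : BooleanSubalgebra (Set X)} {ι : Type*} [Finite ι]
    {f : ι → Set X} (hf : ∀ i, f i ∈ C) : (⋃ i, f i) ∈ C := by
  simpa using C.biUnion_mem (t := Set.univ) Set.finite_univ fun i _ => hf i

lemma BooleanSubalgebra.iInter_mem {C : BooleanSubalgebra (Set X)} {ι : Type*} [Finite ι]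
    {f : ι → Set X} (hf : ∀ i, f i ∈ C) : (⋂ i, f i) ∈ C := by
  rw [← BooleanSubalgebra.compl_mem_iff]
  have := C.iUnion_mem (f := fun i => (f i)ᶜ) fun i => BooleanSubalgebra.compl_mem (hf i)
  rwa [← Set.compl_iInter] at this

/-- A function to `ℕ` with finitely many values all of whose fibres belong to `C`. -/
def FinitelyMeasurable (C : BooleanSubalgebra (Set X)) (s : X → ℕ) : Prop :=
  (Set.range s).Finite ∧ ∀ k, {x | s x = k} ∈ C

/-- Only finitely many tuples of values can occur, so the set is a finite union of intersections of
fibres, whatever `p` is. Real coefficients in the inequalities therefore play no role. -/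
lemma FinitelyMeasurable.setOf_mem {C : BooleanSubalgebra (Set X)} {ι : Type*} [Finite ι]
    {s : ι → X → ℕ} (hs : ∀ i, FinitelyMeasurable C (s i)) (p : (ι → ℕ) → Prop) :
    {x | p fun i => s i x} ∈ C := by
  have hfin : {k | p k ∧ ∀ i, k i ∈ Set.range (s i)}.Finite :=
    (Set.Finite.pi' fun i => (hs i).1).subset fun k hk => hk.2
  have := C.biUnion_mem hfin (f := fun k => ⋂ i, {x | s i x = k i})
    fun k _ => C.iInter_mem fun i => (hs i).2 _
  convert this using 1
  ext x
  simp only [Set.mem_ofPred_eq, Set.mem_iUnion, Set.mem_iInter, exists_prop]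
  constructor
  · exact fun h => ⟨_, ⟨h, fun i => ⟨x, rfl⟩⟩, fun i => rfl⟩
  · rintro ⟨k, ⟨hk, _⟩, h⟩
    rwa [funext h]

lemma FinitelyMeasurable.map₂ {C : BooleanSubalgebra (Set X)} {s t : X → ℕ}
    (hs : FinitelyMeasurable C s) (ht : FinitelyMeasurable C t) (g : ℕ → ℕ → ℕ) :
    FinitelyMeasurable C fun x => g (s x) (t x) := by
  refine ⟨(Set.Finite.image2 g hs.1 ht.1).subset ?_, fun k => ?_⟩
  · rintro _ ⟨x, rfl⟩
    exact ⟨_, ⟨x, rfl⟩, _, ⟨x, rfl⟩, rfl⟩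
  · exact FinitelyMeasurable.setOf_mem (s := fun i : Bool => cond i s t)
      (fun i => by cases i <;> assumption) fun c => g (c true) (c false) = k

/-! ### The rank of a matrix of functions -/

lemma Matrix.exists_linearIndependent_row_submatrix {m n : Type*} [Finite m] [Fintype n]
    (M : Matrix m n L) {k : ℕ} (h : k ≤ M.rank) :
    ∃ r : Fin k → m, LinearIndependent L (M.submatrix r id).row := by
  obtain ⟨f, hf, -, hli⟩ := Submodule.exists_fun_fin_finrank_span_eq L (Set.range M.row)
  choose r hr using hf
  rw [M.rank_eq_finrank_span_row] at h
  refine ⟨r ∘ Fin.castLE h, ?_⟩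
  have : (M.submatrix (r ∘ Fin.castLE h) id).row = f ∘ Fin.castLE h := funext fun i => hr _
  rw [this]
  exact hli.comp _ (Fin.castLE_injective h)

/-- Select `k` independent rows, then `k` independent columns of the resulting matrix. The
selections need not be assumed injective: a repetition makes the minor vanish. -/
lemma Matrix.le_rank_iff_exists_det_submatrix_ne_zero {m n : Type*} [Finite m] [Fintype n]
    (M : Matrix m n L) (k : ℕ) :
    k ≤ M.rank ↔ ∃ (r : Fin k → m) (c : Fin k → n), (M.submatrix r c).det ≠ 0 := by
  constructor
  · intro h
    obtain ⟨r, hr⟩ := M.exists_linearIndependent_row_submatrix h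
    have h1 := hr.rank_matrix
    rw [← Matrix.rank_transpose, Fintype.card_fin] at h1
    obtain ⟨c, hc⟩ := Matrix.exists_linearIndependent_row_submatrix _ h1.ge
    refine ⟨r, c, ?_⟩
    rw [← Matrix.det_transpose]
    have := (Matrix.linearIndependent_rows_iff_isUnit.1 hc)
    exact ((Matrix.isUnit_iff_isUnit_det _).1 this).ne_zero
  · rintro ⟨r, c, h⟩
    have h1 := Matrix.rank_of_det_ne_zero h
    rw [Fintype.card_fin] at h1
    rw [← h1]
    exact Matrix.rank_submatrix_le ..

variable {A : Subring (X → L)} {C : BooleanSubalgebra (Set X)}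

/-- The minors lie in the subring `A`, so rank at least `k` is a finite union of complements of zero
sets; a fibre is a difference of two consecutive such sets. -/
lemma finitelyMeasurable_rank (hAC : ∀ a ∈ A, {x | a x = 0} ∈ C) {m n : Type*} [Finite m]
    [Fintype n] (M : m → n → X → L) (hM : ∀ i j, M i j ∈ A) :
    FinitelyMeasurable C fun x => (Matrix.of fun i j => M i j x).rank := by
  refine ⟨(Set.finite_Iic (Fintype.card n)).subset ?_, fun k => ?_⟩
  · rintro _ ⟨x, rfl⟩
    exact Matrix.rank_le_card_width _
  have hle : ∀ k, {x | k ≤ (Matrix.of fun i j => M i j x).rank} ∈ C := by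
    intro k
    simp only [Matrix.le_rank_iff_exists_det_submatrix_ne_zero, Set.ofPred_exists]
    refine C.iUnion_mem fun r => C.iUnion_mem fun c => ?_
    have hdet : (Matrix.of fun i j => M (r i) (c j)).det ∈ A := by
      rw [Matrix.det_apply]
      exact sum_mem fun σ _ => zsmul_mem (prod_mem fun i _ => hM _ _) _
    have := BooleanSubalgebra.compl_mem (hAC _ hdet)
    convert this using 1
    ext x
    have : (Matrix.of fun i j => M (r i) (c j)).det x =
        ((Matrix.of fun i j => M i j x).submatrix r c).det := by
      exact RingHom.map_det (Pi.evalRingHom (fun _ : X => L) x) _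
    simp [this]
  have := BooleanSubalgebra.sdiff_mem (hle k) (hle (k + 1))
  convert this using 1
  ext x
  simp only [Set.mem_ofPred_eq, Set.mem_sdiff]
  omega

/-! ### Families of linear forms and of positive primitive subspaces -/

/-- A family of linear forms with coefficients in `A`. -/
def IsLinearForm (A : Subring (X → L)) {ι : Type} [Fintype ι] (f : X → (ι → L) → L) : Prop :=
  ∃ a : ι → X → L, (∀ j, a j ∈ A) ∧ ∀ x v, f x v = ∑ j, a j x * v j

namespace IsLinearForm

variable {ι κ : Type} [Fintype ι] [Fintype κ]

lemma coord (i : ι) : IsLinearForm A fun _ v => v i := by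
  classical
  exact ⟨fun j => if j = i then 1 else 0, fun j => by beta_reduce; split_ifs <;> [exact A.one_mem; exact A.zero_mem],
    fun x v => by simp [ite_apply]⟩

lemma zero : IsLinearForm A fun _ (_ : ι → L) => 0 :=
  ⟨0, fun _ => A.zero_mem, fun _ _ => by simp⟩

lemma add {f g : X → (ι → L) → L} (hf : IsLinearForm A f) (hg : IsLinearForm A g) :
    IsLinearForm A fun x v => f x v + g x v := by
  obtain ⟨a, ha, hf⟩ := hf
  obtain ⟨b, hb, hg⟩ := hg
  exact ⟨fun j => a j + b j, fun j => A.add_mem (ha j) (hb j), fun x v => by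
    simp [hf, hg, add_mul, Finset.sum_add_distrib]⟩

lemma smul {c : X → L} (hc : c ∈ A) {f : X → (ι → L) → L} (hf : IsLinearForm A f) :
    IsLinearForm A fun x v => c x * f x v := by
  obtain ⟨a, ha, hf⟩ := hf
  exact ⟨fun j => c * a j, fun j => A.mul_mem hc (ha j), fun x v => by
    simp [hf, Finset.mul_sum, mul_assoc]⟩

lemma sub {f g : X → (ι → L) → L} (hf : IsLinearForm A f) (hg : IsLinearForm A g) :
    IsLinearForm A fun x v => f x v - g x v := by
  have := hf.add (smul (A.neg_mem A.one_mem) hg)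
  simpa [sub_eq_add_neg] using this

lemma sum {σ : Type*} (s : Finset σ) {f : σ → X → (ι → L) → L}
    (hf : ∀ k, IsLinearForm A (f k)) : IsLinearForm A fun x v => ∑ k ∈ s, f k x v := by
  classical
  induction s using Finset.induction_on with
  | empty => simpa using zero
  | insert a s h ih =>
    simp only [Finset.sum_insert h]
    exact (hf a).add ih

lemma comp {f : X → (κ → L) → L} (hf : IsLinearForm A f) {g : κ → X → (ι → L) → L}
    (hg : ∀ k, IsLinearForm A (g k)) : IsLinearForm A fun x v => f x fun k => g k x v := by
  obtain ⟨a, ha, hf⟩ := hf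
  simp only [hf]
  exact sum _ fun k => smul (ha k) (hg k)

lemma comp_reindex {f : X → (κ → L) → L} (hf : IsLinearForm A f) (e : κ → ι) :
    IsLinearForm A fun x v => f x (v ∘ e) :=
  hf.comp fun k => coord (e k)

end IsLinearForm

/-- A family of predicates defined by a positive primitive formula: the existence of a solution of
a system of homogeneous linear equations with coefficients in `A`. -/
def IsPrimitive (A : Subring (X → L)) {ι : Type} [Fintype ι] (P : X → (ι → L) → Prop) : Prop :=
  ∃ (m κ : Type) (_ : Fintype m) (_ : Fintype κ) (f : m → X → (ι ⊕ κ → L) → L),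
    (∀ i, IsLinearForm A (f i)) ∧ ∀ x v, P x v ↔ ∃ u, ∀ i, f i x (Sum.elim v u) = 0

namespace IsPrimitive

variable {ι κ : Type} [Fintype ι] [Fintype κ]

lemma congr {P P' : X → (ι → L) → Prop} (hP : IsPrimitive A P) (h : ∀ x v, P' x v ↔ P x v) :
    IsPrimitive A P' := by
  have : P' = P := by
    ext x v
    exact h x v
  rwa [this]

lemma eq_zero {f : X → (ι → L) → L} (hf : IsLinearForm A f) :
    IsPrimitive A fun x v => f x v = 0 :=
  ⟨Unit, Empty, inferInstance, inferInstance, fun _ x v => f x (v ∘ Sum.inl),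
    fun _ => hf.comp_reindex _, fun x v => by simp⟩

lemma comp {P : X → (κ → L) → Prop} (hP : IsPrimitive A P) {g : κ → X → (ι → L) → L}
    (hg : ∀ k, IsLinearForm A (g k)) : IsPrimitive A fun x v => P x fun k => g k x v := by
  obtain ⟨m, τ, _, _, f, hf, h⟩ := hP
  refine ⟨m, τ, inferInstance, inferInstance,
    fun i x v => f i x fun k => (Sum.elim (fun k => g k x (v ∘ Sum.inl)) (fun k => v (Sum.inr k)) k),
    fun i => (hf i).comp ?_, fun x v => ?_⟩
  · rintro (k | k)
    · exact (hg k).comp_reindex _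
    · exact .coord _
  · simp [h]

lemma comp_reindex {P : X → (κ → L) → Prop} (hP : IsPrimitive A P) (e : κ → ι) :
    IsPrimitive A fun x v => P x (v ∘ e) :=
  hP.comp fun k => .coord (e k)

lemma all {σ : Type} [Finite σ] {P : σ → X → (ι → L) → Prop} (hP : ∀ k, IsPrimitive A (P k)) :
    IsPrimitive A fun x v => ∀ k, P k x v := by
  have := Fintype.ofFinite σ
  choose m κ i₁ i₂ f hf h using hP
  refine ⟨Σ k, m k, Σ k, κ k, inferInstance, inferInstance,
    fun i x v => f i.1 i.2 x (v ∘ Sum.map id (Sigma.mk i.1)),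
    fun i => (hf _ _).comp_reindex _, fun x v => ?_⟩
  simp only [h, Sigma.forall, Sum.elim_comp_map, Function.comp_id]
  constructor
  · intro H
    choose u hu using H
    exact ⟨fun k => u k.1 k.2, hu⟩
  · exact fun ⟨u, hu⟩ k => ⟨_, hu k⟩

lemma trivial : IsPrimitive A fun _ (_ : ι → L) => True := by
  simpa using all (σ := Empty) (P := fun _ _ (_ : ι → L) => True) (A := A) fun k => k.elim

lemma and {P P' : X → (ι → L) → Prop} (hP : IsPrimitive A P) (hP' : IsPrimitive A P') :
    IsPrimitive A fun x v => P x v ∧ P' x v := by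
  simpa using all (σ := Bool) (P := fun b => cond b P' P) (A := A)
    fun b => by cases b <;> assumption

/-- Harmless because `q` does not depend on the point; it serves for conditions such as "this arrow
ends at this vertex". -/
lemma imp {q : Prop} {P : q → X → (ι → L) → Prop} (hP : ∀ h, IsPrimitive A (P h)) :
    IsPrimitive A fun x v => ∀ h, P h x v := by
  by_cases h : q
  · simpa [h] using hP h
  · simpa [h] using trivial

lemma ex {P : X → (ι ⊕ κ → L) → Prop} (hP : IsPrimitive A P) :
    IsPrimitive A fun x v => ∃ u, P x (Sum.elim v u) := by
  obtain ⟨m, τ, _, _, f, hf, h⟩ := hP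
  refine ⟨m, κ ⊕ τ, inferInstance, inferInstance,
    fun i x v => f i x (v ∘ (Equiv.sumAssoc ι κ τ)), fun i => (hf i).comp_reindex _, fun x v => ?_⟩
  have key : ∀ (u : κ → L) (w : τ → L),
      Sum.elim v (Sum.elim u w) ∘ Equiv.sumAssoc ι κ τ = Sum.elim (Sum.elim v u) w := by
    intro u w
    ext ((k | k) | k) <;> rfl
  simp only [h]
  constructor
  · rintro ⟨u, w, hw⟩
    exact ⟨Sum.elim u w, fun i => by rw [key]; exact hw i⟩
  · rintro ⟨u, hu⟩
    exact ⟨u ∘ Sum.inl, u ∘ Sum.inr, fun i => by rw [← key, Sum.elim_comp_inl_inr]; exact hu i⟩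

/-- Let `M` be the matrix of the system and `N` its block of columns belonging to the quantified
variables. Then `S x` is the projection of `ker M`, and the part of `ker M` killed by the projection
is `ker N`, so `dim S = dim ker M - dim ker N`. -/
lemma finitelyMeasurable_finrank (hAC : ∀ a ∈ A, {x | a x = 0} ∈ C) {P : X → (ι → L) → Prop}
    (hP : IsPrimitive A P) (S : X → Submodule L (ι → L)) (hS : ∀ x v, v ∈ S x ↔ P x v) :
    FinitelyMeasurable C fun x => Module.finrank L (S x) := by
  obtain ⟨m, κ, _, _, f, hf, h⟩ := hP
  choose a ha hf using hf
  have hM := finitelyMeasurable_rank hAC a ha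
  have hN := finitelyMeasurable_rank hAC (fun i k => a i (Sum.inr k)) fun i k => ha i _
  convert hM.map₂ hN
    fun r s => (Fintype.card ι + Fintype.card κ - r) - (Fintype.card κ - s) using 2 with x
  set M : Matrix m (ι ⊕ κ) L := Matrix.of fun i j => a i j x
  set N : Matrix m κ L := Matrix.of fun i k => a i (Sum.inr k) x
  have h1 := M.mulVecLin.finrank_range_add_finrank_ker
  have h2 := N.mulVecLin.finrank_range_add_finrank_ker
  change M.rank + _ = _ at h1
  change N.rank + _ = _ at h2
  rw [Module.finrank_fintype_fun_eq_card] at h1 h2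
  rw [Fintype.card_sum] at h1
  let p : (ι ⊕ κ → L) →ₗ[L] (ι → L) := LinearMap.funLeft L L Sum.inl
  have hfM : ∀ w i, f i x w = (M.mulVec w) i := fun w i => hf i x w
  have hmap : (LinearMap.ker M.mulVecLin).map p = S x := by
    ext v
    rw [hS, h]
    constructor
    · rintro ⟨w, hw, rfl⟩
      refine ⟨w ∘ Sum.inr, fun i => ?_⟩
      have : Sum.elim (p w) (w ∘ Sum.inr) = w := Sum.elim_comp_inl_inr w
      rw [this, hfM]
      exact congrFun hw i
    · rintro ⟨u, hu⟩
      refine ⟨Sum.elim v u, funext fun i => ?_, rfl⟩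
      exact (hfM _ i).symm.trans (hu i)
  have h3 := (p.domRestrict (LinearMap.ker M.mulVecLin)).finrank_range_add_finrank_ker
  rw [LinearMap.range_domRestrict, hmap] at h3
  have hNM : ∀ u : κ → L, M.mulVec (Sum.elim (0 : ι → L) u) = N.mulVec u := by
    intro u
    ext i
    simp [M, N, Matrix.mulVec, dotProduct]
  -- The vectors of `ker M` that project to zero are exactly those of the form `(0, u)` with `N u =
  -- 0`.
  let e : LinearMap.ker (p.domRestrict (LinearMap.ker M.mulVecLin)) ≃ₗ[L]
      LinearMap.ker N.mulVecLin :=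
    { toFun := fun w => ⟨w.1.1 ∘ Sum.inr, by
        have hw : Sum.elim (0 : ι → L) (w.1.1 ∘ Sum.inr) = w.1.1 := by
          rw [← show w.1.1 ∘ Sum.inl = 0 from w.2, Sum.elim_comp_inl_inr]
        rw [LinearMap.mem_ker, Matrix.mulVecLin_apply, ← hNM, hw]
        exact w.1.2⟩
      map_add' := fun _ _ => rfl
      map_smul' := fun _ _ => rfl
      invFun := fun u => ⟨⟨Sum.elim (0 : ι → L) u.1, by
        rw [LinearMap.mem_ker, Matrix.mulVecLin_apply, hNM]
        exact u.2⟩, rfl⟩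
      left_inv := fun w => by
        ext1; ext1
        change Sum.elim (0 : ι → L) (w.1.1 ∘ Sum.inr) = w.1.1
        rw [← show w.1.1 ∘ Sum.inl = 0 from w.2, Sum.elim_comp_inl_inr]
      right_inv := fun u => rfl }
  have h4 := e.finrank_eq
  omega

end IsPrimitive

end Definability

/-! ### Stabilisation of monotone iterations of bounded length -/

section IterateFixed

variable {α : Type*} [PartialOrder α] {F : α → α} {d : α → ℕ}

/-- Each application of `F` that moves the point lowers `d`, which can happen at most `d x` times.
-/
lemma iterate_fixed_of_le_self (hF : ∀ x, F x ≤ x) (hd : StrictMono d) {N : ℕ} {x : α}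
    (hN : d x ≤ N) : F (F^[N] x) = F^[N] x := by
  induction N generalizing x with
  | zero =>
    by_contra h
    have := hd (lt_of_le_of_ne (hF x) h)
    omega
  | succ N ih =>
    by_cases h : F x = x
    · rw [Function.iterate_fixed h, h]
    · have := hd (lt_of_le_of_ne (hF x) h)
      exact ih (x := F x) (by omega)

lemma iterate_fixed_of_self_le (hF : ∀ x, x ≤ F x) (hd : StrictMono d) {D N : ℕ}
    (hD : ∀ x, d x ≤ D) {x : α} (hN : D ≤ d x + N) : F (F^[N] x) = F^[N] x := by
  induction N generalizing x with
  | zero =>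
    by_contra h
    have := hd (lt_of_le_of_ne (hF x) (Ne.symm h))
    have := hD (F x)
    omega
  | succ N ih =>
    by_cases h : F x = x
    · rw [Function.iterate_fixed h, h]
    · have := hd (lt_of_le_of_ne (hF x) (Ne.symm h))
      exact ih (x := F x) (by omega)

end IterateFixed

/-! ### Epimorphic part and monomorphic kernel as bounded iterations -/

namespace QuiverRep

variable {L : Type v} [Field L] {Q : FinQuiver} (φ : QuiverRep L Q)

/-- The total dimension of a family of subspaces. -/
noncomputable def totalDim (W : ∀ x, Submodule L (φ.space x)) : ℕ :=
  ∑ x, Module.finrank L (W x)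

lemma totalDim_strictMono : StrictMono φ.totalDim := by
  intro W W' h
  obtain ⟨hle, x, hx⟩ := Pi.lt_def.1 h
  exact Finset.sum_lt_sum (fun y _ => Submodule.finrank_mono (hle y))
    ⟨x, Finset.mem_univ x, Submodule.finrank_lt_finrank_of_lt hx⟩

lemma totalDim_le (W : ∀ x, Submodule L (φ.space x)) :
    φ.totalDim W ≤ ∑ x, Module.finrank L (φ.space x) :=
  Finset.sum_le_sum fun _x _ => Submodule.finrank_le _

/-- Shrink a family of subspaces, intersecting it with the images and preimages of its members. -/
def epiStep (W : ∀ x, Submodule L (φ.space x)) : ∀ x, Submodule L (φ.space x) := fun x =>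
  W x ⊓ ((⨅ (a) (h : Q.head a = x), h ▸ (W (Q.tail a)).map (φ.map a)) ⊓
    ⨅ (a) (h : Q.tail a = x), h ▸ (W (Q.head a)).comap (φ.map a))

/-- Enlarge a family of subspaces, adding to it the images and preimages of its members. -/
def monoStep (W : ∀ x, Submodule L (φ.space x)) : ∀ x, Submodule L (φ.space x) := fun x =>
  W x ⊔ ((⨆ a : {a // Q.head a = x}, a.2 ▸ (W (Q.tail a)).map (φ.map a)) ⊔
    ⨆ a : {a // Q.tail a = x}, a.2 ▸ (W (Q.head a)).comap (φ.map a))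

lemma le_epiStep {V W : ∀ x, Submodule L (φ.space x)}
    (hV : ∀ a, (V (Q.tail a)).map (φ.map a) = V (Q.head a)) (h : V ≤ W) : V ≤ φ.epiStep W := by
  intro x
  refine le_inf (h x) (le_inf (le_iInf fun a => le_iInf ?_) (le_iInf fun a => le_iInf ?_))
  · rintro rfl
    exact (hV a).ge.trans (Submodule.map_mono (h _))
  · rintro rfl
    exact Submodule.map_le_iff_le_comap.1 ((hV a).le.trans (h _))

lemma monoStep_le {V W : ∀ x, Submodule L (φ.space x)}
    (hV : ∀ a, (V (Q.head a)).comap (φ.map a) = V (Q.tail a)) (h : W ≤ V) :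
    φ.monoStep W ≤ V := by
  intro x
  refine sup_le (h x) (sup_le (iSup_le ?_) (iSup_le ?_))
  · rintro ⟨a, rfl⟩
    exact Submodule.map_le_iff_le_comap.2 ((h _).trans (hV a).ge)
  · rintro ⟨a, rfl⟩
    exact (Submodule.comap_mono (h _)).trans (hV a).le

lemma epiStep_le (W : ∀ x, Submodule L (φ.space x)) : φ.epiStep W ≤ W :=
  fun _ => inf_le_left

lemma epiStep_le_map (W : ∀ x, Submodule L (φ.space x)) (a : Q.Arrow) :
    φ.epiStep W (Q.head a) ≤ (W (Q.tail a)).map (φ.map a) := by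
  refine (inf_le_right.trans inf_le_left).trans ?_
  exact iInf₂_le (f := fun b (h : Q.head b = Q.head a) =>
    (h ▸ (W (Q.tail b)).map (φ.map b) : Submodule L (φ.space (Q.head a)))) a rfl

lemma epiStep_le_comap (W : ∀ x, Submodule L (φ.space x)) (a : Q.Arrow) :
    φ.epiStep W (Q.tail a) ≤ (W (Q.head a)).comap (φ.map a) := by
  refine (inf_le_right.trans inf_le_right).trans ?_
  exact iInf₂_le (f := fun b (h : Q.tail b = Q.tail a) =>
    (h ▸ (W (Q.head b)).comap (φ.map b) : Submodule L (φ.space (Q.tail a)))) a rfl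

lemma le_monoStep (W : ∀ x, Submodule L (φ.space x)) : W ≤ φ.monoStep W :=
  fun _ => le_sup_left

lemma map_le_monoStep (W : ∀ x, Submodule L (φ.space x)) (a : Q.Arrow) :
    (W (Q.tail a)).map (φ.map a) ≤ φ.monoStep W (Q.head a) := by
  refine le_trans ?_ (le_sup_left.trans le_sup_right)
  exact le_iSup (fun b : {b // Q.head b = Q.head a} =>
    (b.2 ▸ (W (Q.tail b)).map (φ.map b) : Submodule L (φ.space (Q.head a)))) ⟨a, rfl⟩

lemma comap_le_monoStep (W : ∀ x, Submodule L (φ.space x)) (a : Q.Arrow) :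
    (W (Q.head a)).comap (φ.map a) ≤ φ.monoStep W (Q.tail a) := by
  refine le_trans ?_ (le_sup_right.trans le_sup_right)
  exact le_iSup (fun b : {b // Q.tail b = Q.tail a} =>
    (b.2 ▸ (W (Q.head b)).comap (φ.map b) : Submodule L (φ.space (Q.tail a)))) ⟨a, rfl⟩

/-- The epimorphic part survives every step. Conversely the iterate is stable once `N` reaches the
total dimension, and a stable family is mapped by each arrow onto its member at the head. Any larger
`N` is allowed so that one number serves a whole family. -/
lemma epiPart_eq_iterate {N : ℕ} (hN : ∑ x, Module.finrank L (φ.space x) ≤ N) :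
    φ.epiPart = φ.epiStep^[N] ⊤ := by
  apply le_antisymm
  · have hE := (φ.epi_iff _).1 φ.isGreatest_epiPart.1
    clear hN
    induction N with
    | zero => exact le_top
    | succ N ih =>
      rw [Function.iterate_succ_apply']
      exact φ.le_epiStep hE ih
  · have hfix := iterate_fixed_of_le_self (F := φ.epiStep) φ.epiStep_le
      φ.totalDim_strictMono ((φ.totalDim_le ⊤).trans hN)
    refine φ.isGreatest_epiPart.2 ((φ.epi_iff _).2 fun a => le_antisymm ?_ ?_)
    · rw [Submodule.map_le_iff_le_comap]
      conv_lhs => rw [← hfix]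
      exact φ.epiStep_le_comap _ a
    · conv_lhs => rw [← hfix]
      exact φ.epiStep_le_map _ a

lemma monoKer_eq_iterate {N : ℕ} (hN : ∑ x, Module.finrank L (φ.space x) ≤ N) :
    φ.monoKer = φ.monoStep^[N] ⊥ := by
  apply le_antisymm
  · have hfix := iterate_fixed_of_self_le (F := φ.monoStep) φ.le_monoStep
      φ.totalDim_strictMono φ.totalDim_le (x := ⊥) (N := N) (hN.trans (Nat.le_add_left _ _))
    refine φ.isLeast_monoKer.2 ((φ.mono_iff _).2 fun a => le_antisymm ?_ ?_)
    · conv_rhs => rw [← hfix]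
      exact φ.comap_le_monoStep _ a
    · rw [← Submodule.map_le_iff_le_comap]
      conv_rhs => rw [← hfix]
      exact φ.map_le_monoStep _ a
  · have hN' := (φ.mono_iff _).1 φ.isLeast_monoKer.1
    clear hN
    induction N with
    | zero => exact bot_le
    | succ N ih =>
      rw [Function.iterate_succ_apply']
      exact φ.monoStep_le hN' ih

lemma pushforward_map_apply {Q' : FinQuiver} (f : FinQuiver.Hom Q Q') (a : Q'.Arrow)
    (w : ∀ z : {z // f.onVertex z = Q'.tail a}, φ.space z)
    (z : {z // f.onVertex z = Q'.head a}) :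
    (φ.pushforward f).map a w z = ∑ b : {b : Q.Arrow // f.onArrow b = a},
      (Pi.single ⟨Q.head b, by rw [← f.head_eq, b.2]⟩
        (φ.map b.1 (w ⟨Q.tail b, by rw [← f.tail_eq, b.2]⟩)) :
        ∀ z : {z // f.onVertex z = Q'.head a}, φ.space z) z := by
  change (∑ b : {b : Q.Arrow // f.onArrow b = a},
    LinearMap.single L (fun y : {y // f.onVertex y = Q'.head a} => φ.space y)
        ⟨Q.head b, by rw [← f.head_eq, b.2]⟩ ∘ₗ
      φ.map b ∘ₗ
        LinearMap.proj (φ := fun y : {y // f.onVertex y = Q'.tail a} => φ.space y)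
          ⟨Q.tail b, by rw [← f.tail_eq, b.2]⟩) w z = _
  rw [LinearMap.sum_apply, Finset.sum_apply]
  rfl

/-! ### Presentations of families of representations by linear equations -/

variable {X : Type*}

/-- A presentation of a family of representations by vector spaces of column vectors, such that the
relations and the maps of the representations are given by linear equations with coefficients
in `A`. -/
structure Presentation (A : Subring (X → L)) (ρ : X → QuiverRep L Q) where
  gen : Q.Vertex → Type
  [fintypeGen : ∀ y, Fintype (gen y)]
  proj : ∀ x y, (gen y → L) →ₗ[L] (ρ x).space y
  proj_surjective : ∀ x y, Function.Surjective (proj x y)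
  ker : ∀ y, IsPrimitive A fun x v => proj x y v = 0
  graph : ∀ a, IsPrimitive A fun x (v : gen (Q.tail a) ⊕ gen (Q.head a) → L) =>
    (ρ x).map a (proj x _ (v ∘ Sum.inl)) = proj x _ (v ∘ Sum.inr)

attribute [instance] Presentation.fintypeGen

namespace Presentation

variable {A : Subring (X → L)} {C : BooleanSubalgebra (Set X)} {ρ : X → QuiverRep L Q}
  (D : Presentation A ρ)

lemma finrank_le (x : X) (y : Q.Vertex) :
    Module.finrank L ((ρ x).space y) ≤ Fintype.card (D.gen y) := by
  rw [← Module.finrank_fintype_fun_eq_card L]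
  exact LinearMap.finrank_le_finrank_of_surjective (D.proj_surjective x y)

/-- A family of subspaces at the vertex `y` that is primitive in terms of the generators. -/
def Primitive {y : Q.Vertex} (W : ∀ x, Submodule L ((ρ x).space y)) : Prop :=
  IsPrimitive A fun x v => D.proj x y v ∈ W x

variable {D}

lemma Primitive.top {y : Q.Vertex} : D.Primitive (y := y) fun _ => ⊤ :=
  IsPrimitive.trivial.congr fun _ _ => by simp

lemma Primitive.bot {y : Q.Vertex} : D.Primitive (y := y) fun _ => ⊥ :=
  (D.ker y).congr fun _ _ => by simp

lemma Primitive.inf {y : Q.Vertex} {W W' : ∀ x, Submodule L ((ρ x).space y)}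
    (hW : D.Primitive W) (hW' : D.Primitive W') : D.Primitive fun x => W x ⊓ W' x :=
  IsPrimitive.and hW hW'

lemma Primitive.iInf {ι : Type} [Finite ι] {y : Q.Vertex}
    {W : ι → ∀ x, Submodule L ((ρ x).space y)}
    (hW : ∀ i, D.Primitive (W i)) : D.Primitive fun x => ⨅ i, W i x :=
  (IsPrimitive.all hW).congr fun _ _ => by simp

lemma Primitive.iInf_prop {q : Prop} {y : Q.Vertex} {W : q → ∀ x, Submodule L ((ρ x).space y)}
    (hW : ∀ h, D.Primitive (W h)) : D.Primitive fun x => ⨅ h, W h x :=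
  (IsPrimitive.imp hW).congr fun _ _ => by simp

/-- An element of the sum is a sum of members of the `W i`. Their lifts to generators are
quantified, one block of variables per summand, and the equation is imposed only modulo the kernel
of `proj`. -/
lemma Primitive.iSup {ι : Type} [Finite ι] {y : Q.Vertex}
    {W : ι → ∀ x, Submodule L ((ρ x).space y)}
    (hW : ∀ i, D.Primitive (W i)) : D.Primitive fun x => ⨆ i, W i x := by
  have := Fintype.ofFinite ι
  have h1 : IsPrimitive A fun x (v : D.gen y ⊕ (ι × D.gen y) → L) =>
      ∀ i, D.proj x y (v ∘ fun g => Sum.inr (i, g)) ∈ W i x :=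
    IsPrimitive.all fun i => IsPrimitive.comp_reindex (hW i) _
  have h2 : IsPrimitive A fun x (v : D.gen y ⊕ (ι × D.gen y) → L) =>
      D.proj x y (fun g => v (Sum.inl g) - ∑ i, v (Sum.inr (i, g))) = 0 :=
    (D.ker y).comp fun g => (IsLinearForm.coord _).sub (IsLinearForm.sum _ fun i => .coord _)
  refine (h1.and h2).ex.congr fun x v => ?_
  rw [Submodule.mem_iSup_iff_exists_finsupp]
  constructor
  · rintro ⟨f, hf, hsum⟩
    choose u hu using fun i => D.proj_surjective x y (f i)
    refine ⟨fun p => u p.1 p.2, fun i => ?_, ?_⟩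
    · exact (hu i).symm ▸ hf i
    · have : (fun g => v g - ∑ i, u i g) = v - ∑ i, u i := by
        ext g
        simp
      simp only [Sum.elim_inl, Sum.elim_inr]
      rw [this, map_sub, map_sum, ← hsum, Finsupp.sum_fintype _ _ fun _ => rfl]
      simp [hu]
  · rintro ⟨u, hu, h⟩
    refine ⟨Finsupp.equivFunOnFinite.symm fun i => D.proj x y fun g => u (i, g), hu, ?_⟩
    have : (fun g => v g - ∑ i, u (i, g)) = v - ∑ i, fun g => u (i, g) := by
      ext g
      simp
    simp only [Sum.elim_inl, Sum.elim_inr] at h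
    rw [this, map_sub, map_sum, sub_eq_zero] at h
    rw [h, Finsupp.sum_fintype _ _ fun _ => rfl]
    rfl

lemma Primitive.sup {y : Q.Vertex} {W W' : ∀ x, Submodule L ((ρ x).space y)}
    (hW : D.Primitive W) (hW' : D.Primitive W') : D.Primitive fun x => W x ⊔ W' x := by
  have := Primitive.iSup (D := D) (W := fun b : Bool => cond b W W')
    fun b => by cases b <;> assumption
  simpa [iSup_bool_eq] using this

lemma Primitive.map {a : Q.Arrow} {W : ∀ x, Submodule L ((ρ x).space (Q.tail a))}
    (hW : D.Primitive W) :
    D.Primitive fun x => (W x).map ((ρ x).map a) := by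
  refine ((IsPrimitive.comp_reindex hW Sum.inr).and
    ((D.graph a).comp_reindex Sum.swap)).ex.congr fun x v => ?_
  constructor
  · rintro ⟨w, hw, h⟩
    obtain ⟨u, rfl⟩ := D.proj_surjective x _ w
    exact ⟨u, hw, h⟩
  · exact fun ⟨u, hu, h⟩ => ⟨_, hu, h⟩

/-- The arrow is known only through its graph on generators, so a lift of the image vector has to be
quantified; the choice of the lift does not matter. -/
lemma Primitive.comap {a : Q.Arrow} {W : ∀ x, Submodule L ((ρ x).space (Q.head a))}
    (hW : D.Primitive W) :
    D.Primitive fun x => (W x).comap ((ρ x).map a) := by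
  refine ((IsPrimitive.comp_reindex hW Sum.inr).and (D.graph a)).ex.congr fun x v => ?_
  constructor
  · intro hv
    obtain ⟨u, hu⟩ := D.proj_surjective x _ ((ρ x).map a (D.proj x _ v))
    exact ⟨u, hu.symm ▸ hv, hu.symm⟩
  · rintro ⟨u, hu, h⟩
    have h' : (ρ x).map a (D.proj x _ v) = D.proj x _ u := h
    change (ρ x).map a (D.proj x _ v) ∈ W x
    rw [h']
    exact hu

lemma Primitive.epiStep {W : ∀ x y, Submodule L ((ρ x).space y)}
    (hW : ∀ y, D.Primitive fun x => W x y) (y : Q.Vertex) :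
    D.Primitive fun x => (ρ x).epiStep (W x) y := by
  refine (hW y).inf (.inf (.iInf fun a => .iInf_prop ?_) (.iInf fun a => .iInf_prop ?_))
  · rintro rfl
    exact (hW _).map
  · rintro rfl
    exact (hW _).comap

lemma Primitive.monoStep {W : ∀ x y, Submodule L ((ρ x).space y)}
    (hW : ∀ y, D.Primitive fun x => W x y) (y : Q.Vertex) :
    D.Primitive fun x => (ρ x).monoStep (W x) y := by
  refine (hW y).sup (.sup (.iSup ?_) (.iSup ?_))
  · rintro ⟨a, rfl⟩
    exact (hW _).map
  · rintro ⟨a, rfl⟩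
    exact (hW _).comap

lemma sum_finrank_le (D : Presentation A ρ) (x : X) :
    ∑ y, Module.finrank L ((ρ x).space y) ≤ ∑ y, Fintype.card (D.gen y) :=
  Finset.sum_le_sum fun y _ => D.finrank_le x y

lemma primitive_epiPart (D : Presentation A ρ) (y : Q.Vertex) : D.Primitive fun x => (ρ x).epiPart y := by
  -- The total number of generators bounds the total dimension at every `x`, so the same number of
  -- steps works for the whole family even if dimensions jump.
  simp only [fun x => (ρ x).epiPart_eq_iterate (D.sum_finrank_le x)]
  generalize ∑ y, Fintype.card (D.gen y) = N
  induction N generalizing y with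
  | zero => exact .top
  | succ N ih =>
    simp only [Function.iterate_succ_apply']
    exact .epiStep ih y

lemma primitive_monoKer (D : Presentation A ρ) (y : Q.Vertex) : D.Primitive fun x => (ρ x).monoKer y := by
  simp only [fun x => (ρ x).monoKer_eq_iterate (D.sum_finrank_le x)]
  generalize ∑ y, Fintype.card (D.gen y) = N
  induction N generalizing y with
  | zero => exact .bot
  | succ N ih =>
    simp only [Function.iterate_succ_apply']
    exact .monoStep ih y

/-- With `E` the epimorphic part and `N` the monomorphic kernel, the rank is `dim E - dim (E ∩ N)`.
Passing to preimages in the generator space adds the dimension of the kernel of `proj` to both terms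
and leaves the difference unchanged. -/
lemma finitelyMeasurable_globalRank (D : Presentation A ρ) (hAC : ∀ a ∈ A, {x | a x = 0} ∈ C) (hQ : Q.IsConnected) :
    FinitelyMeasurable C fun x => (ρ x).globalRank hQ := by
  have hE := D.primitive_epiPart hQ.1.some
  have h1 := hE.finitelyMeasurable_finrank hAC (fun x => ((ρ x).epiPart _).comap (D.proj x _))
    fun _ _ => Iff.rfl
  have h2 := (hE.inf (D.primitive_monoKer hQ.1.some)).finitelyMeasurable_finrank hAC
    (fun x => ((ρ x).epiPart _ ⊓ (ρ x).monoKer _).comap (D.proj x _)) fun _ _ => Iff.rfl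
  convert h1.map₂ h2 fun i j => i - j using 2 with x
  set y := hQ.1.some
  set E := ((ρ x).epiPart y).comap (D.proj x y)
  let g := ((ρ x).monoKer y).mkQ ∘ₗ D.proj x y
  have hrank : (ρ x).rankSpace y = E.map g := by
    rw [rankSpace, Submodule.map_comp, Submodule.map_comap_eq_of_surjective (D.proj_surjective x y)]
  have hker : LinearMap.ker g = ((ρ x).monoKer y).comap (D.proj x y) := by
    rw [LinearMap.ker_comp, Submodule.ker_mkQ]
  have h := (g.domRestrict E).finrank_range_add_finrank_ker
  rw [LinearMap.range_domRestrict, ← hrank, LinearMap.ker_domRestrict,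
    ← Submodule.finrank_map_subtype_eq E, Submodule.map_comap_subtype, hker,
    ← Submodule.comap_inf] at h
  change Module.finrank L ((ρ x).rankSpace y) = _
  omega

/-- With the vertices `t` and `h` as variables, substitution removes the casts that occur in the
maps of a pullback. -/
lemma graph_cast (D : Presentation A ρ) (a : Q.Arrow) (t h : Q.Vertex) (ht : t = Q.tail a) (hh : Q.head a = h) :
    IsPrimitive A fun x (v : D.gen t ⊕ D.gen h → L) =>
      LinearEquiv.cast (R := L) (M := (ρ x).space) hh ((ρ x).map a
        (LinearEquiv.cast (R := L) (M := (ρ x).space) ht (D.proj x t (v ∘ Sum.inl)))) =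
      D.proj x h (v ∘ Sum.inr) := by
  subst ht hh
  exact D.graph a

/-- The presentation of the pullback. -/
def pullback (D : Presentation A ρ) {Q' : FinQuiver} (f : FinQuiver.Hom Q' Q) :
    Presentation A fun x => (ρ x).pullback f where
  gen y := D.gen (f.onVertex y)
  proj x y := D.proj x (f.onVertex y)
  proj_surjective x _y := D.proj_surjective x _
  ker _y := D.ker _
  graph b := D.graph_cast (f.onArrow b) _ _ (f.tail_eq b).symm (f.head_eq b)

/-- The presentation of the pushforward. -/
def pushforward (D : Presentation A ρ) {Q' : FinQuiver} (f : FinQuiver.Hom Q Q') :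
    Presentation A fun x => (ρ x).pushforward f where
  gen y := Σ z : {z // f.onVertex z = y}, D.gen z
  proj x y := LinearMap.pi fun z : {z // f.onVertex z = y} => D.proj x z ∘ₗ LinearMap.funLeft L L
    fun g : D.gen z => (⟨z, g⟩ : Σ z : {z // f.onVertex z = y}, D.gen z)
  proj_surjective x y w := by
    choose u hu using fun z : {z // f.onVertex z = y} => D.proj_surjective x z (w z)
    exact ⟨fun p => u p.1 p.2, funext hu⟩
  ker y := (IsPrimitive.all fun z : {z // f.onVertex z = y} => (D.ker z.1).comp_reindex
    fun g => (⟨z, g⟩ : Σ z : {z // f.onVertex z = y}, D.gen z)).congr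
    fun x v => funext_iff
  graph a := by
    let hd (b : {b : Q.Arrow // f.onArrow b = a}) : {z // f.onVertex z = Q'.head a} :=
      ⟨Q.head b, by rw [← f.head_eq, b.2]⟩
    let tl (b : {b : Q.Arrow // f.onArrow b = a}) : {z // f.onVertex z = Q'.tail a} :=
      ⟨Q.tail b, by rw [← f.tail_eq, b.2]⟩
    -- The quantified variables are, for each arrow `b` over `a`, generator coordinates of a lift of
    -- the image under `b`.
    have h1 : IsPrimitive A fun x (v : ((Σ z : {z // f.onVertex z = Q'.tail a}, D.gen z) ⊕
        (Σ z : {z // f.onVertex z = Q'.head a}, D.gen z)) ⊕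
        (Σ b : {b : Q.Arrow // f.onArrow b = a}, D.gen (Q.head b)) → L) =>
        ∀ b : {b : Q.Arrow // f.onArrow b = a},
          (ρ x).map b.1 (D.proj x _ fun g => v (Sum.inl (Sum.inl ⟨tl b, g⟩))) =
            D.proj x _ fun g => v (Sum.inr ⟨b, g⟩) :=
      IsPrimitive.all fun b => (D.graph b.1).comp fun k =>
        IsLinearForm.coord (ι := ((Σ z : {z // f.onVertex z = Q'.tail a}, D.gen z) ⊕
          (Σ z : {z // f.onVertex z = Q'.head a}, D.gen z)) ⊕
          (Σ b : {b : Q.Arrow // f.onArrow b = a}, D.gen (Q.head b)))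
          (Sum.elim (fun g => Sum.inl (Sum.inl ⟨tl b, g⟩)) (fun g => Sum.inr ⟨b, g⟩) k)
    -- At each vertex `z` over the head, the target component equals, modulo relations, the sum of
    -- the lifts of those arrows over `a` that end at `z`.
    have h2 : IsPrimitive A fun x (v : ((Σ z : {z // f.onVertex z = Q'.tail a}, D.gen z) ⊕
        (Σ z : {z // f.onVertex z = Q'.head a}, D.gen z)) ⊕
        (Σ b : {b : Q.Arrow // f.onArrow b = a}, D.gen (Q.head b)) → L) =>
        ∀ z : {z // f.onVertex z = Q'.head a},
          D.proj x z (fun g => v (Sum.inl (Sum.inr ⟨z, g⟩)) -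
            ∑ b, (Pi.single (hd b) (fun g => v (Sum.inr ⟨b, g⟩)) :
              ∀ z : {z // f.onVertex z = Q'.head a}, D.gen z → L) z g) = 0 := by
      refine IsPrimitive.all fun z => (D.ker z.1).comp fun g =>
        (IsLinearForm.coord _).sub (IsLinearForm.sum _ fun b => ?_)
      by_cases hz : z = hd b
      · subst hz
        simp only [Pi.single_eq_same]
        exact .coord _
      · simp only [Pi.single_eq_of_ne hz]
        exact .zero
    refine (h1.and h2).ex.congr fun x v => ?_
    have key : ∀ (w : ∀ b : {b : Q.Arrow // f.onArrow b = a}, D.gen (Q.head b) → L)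
        (_ : ∀ b, (ρ x).map b.1 (D.proj x _ fun g => v (Sum.inl ⟨tl b, g⟩)) = D.proj x _ (w b))
        (z : {z // f.onVertex z = Q'.head a}),
        ((ρ x).pushforward f).map a (fun z => D.proj x z fun g => v (Sum.inl ⟨z, g⟩)) z =
          D.proj x z (∑ b, (Pi.single (hd b) (w b) :
              ∀ z : {z // f.onVertex z = Q'.head a}, D.gen z → L) z) := by
      intro w hw z
      rw [map_sum, pushforward_map_apply]
      refine Finset.sum_congr rfl fun b _ => ?_
      change (Pi.single (hd b) ((ρ x).map b.1 (D.proj x _ fun g => v (Sum.inl ⟨tl b, g⟩))) :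
        ∀ z : {z // f.onVertex z = Q'.head a}, (ρ x).space z) z = _
      rw [hw]
      by_cases hz : z = hd b
      · subst hz
        simp only [Pi.single_eq_same]
        rfl
      · simp only [Pi.single_eq_of_ne hz, map_zero]
    have hsum : ∀ (w : ∀ b : {b : Q.Arrow // f.onArrow b = a}, D.gen (Q.head b) → L)
        (z : {z // f.onVertex z = Q'.head a}),
        D.proj x z (fun g => v (Sum.inr ⟨z, g⟩) - ∑ b, (Pi.single (hd b) (w b) :
              ∀ z : {z // f.onVertex z = Q'.head a}, D.gen z → L) z g) =
          D.proj x z (fun g => v (Sum.inr ⟨z, g⟩)) - D.proj x z (∑ b, (Pi.single (hd b) (w b) :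
              ∀ z : {z // f.onVertex z = Q'.head a}, D.gen z → L) z) := by
      intro w z
      rw [← map_sub]
      congr 1
      ext g
      simp
    constructor
    · intro h
      choose w hw using fun b : {b : Q.Arrow // f.onArrow b = a} => D.proj_surjective x _
        ((ρ x).map b.1 (D.proj x _ fun g => v (Sum.inl ⟨tl b, g⟩)))
      refine ⟨fun p => w p.1 p.2, fun b => (hw b).symm, fun z => ?_⟩
      refine (hsum w z).trans ?_
      rw [← key w (fun b => (hw b).symm), sub_eq_zero]
      exact (congrFun h z).symm
    · rintro ⟨u, hu, h⟩
      funext z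
      refine (key (fun b g => u ⟨b, g⟩) hu z).trans ?_
      have := (hsum (fun b g => u ⟨b, g⟩) z).symm.trans (h z)
      exact (sub_eq_zero.1 this).symm

end Presentation

end QuiverRep

/-- Each pullback or pushforward in the chain transports the presentation without changing `A`,
until the global rank is reached. -/
lemma IsRankFunction.finitelyMeasurable {L : Type v} [Field L] {X : Type*} {A : Subring (X → L)}
    {C : BooleanSubalgebra (Set X)} (hAC : ∀ a ∈ A, {x | a x = 0} ∈ C) {Q : FinQuiver}
    {r : QuiverRep L Q → ℕ} (hr : IsRankFunction L Q r) {ρ : X → QuiverRep L Q}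
    (D : QuiverRep.Presentation A ρ) : FinitelyMeasurable C fun x => r (ρ x) := by
  induction hr with
  | globalRank Q hQ => exact D.finitelyMeasurable_globalRank hAC hQ
  | pullback Q Q' f r _ ih => exact ih (D.pullback f)
  | pushforward Q Q' f r _ ih => exact ih (D.pushforward f)

/-! ### Presentations of the sub- and quotient representations from coordinates -/

namespace SubrepBundle

variable {X : Type*} {L : Type v} [Field L] {A : Subring (X → L)} {Q : FinQuiver}
  {α β : Q.Vertex → ℕ} {p : X → SubrepBundle L Q α β}

/-- Frames of the subspaces and matrices of the representations of a family of points of the bundle,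
with entries in `A`. -/
structure CoordinateFamily (A : Subring (X → L)) (p : X → SubrepBundle L Q α β) where
  vec : ∀ y, Fin (β y) → Fin (α y) → X → L
  vec_mem : ∀ y j i, vec y j i ∈ A
  span_vec : ∀ x y, Submodule.span L (Set.range fun j i => vec y j i x) = ((p x).1.1 y).1
  mat : ∀ a : Q.Arrow, Fin (α (Q.head a)) → Fin (α (Q.tail a)) → X → L
  mat_mem : ∀ a i j, mat a i j ∈ A
  map_apply : ∀ x a v i, (p x).1.2 a v i = ∑ j, mat a i j x * v j

namespace CoordinateFamily

variable (E : CoordinateFamily A p)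

/-- The linear combinations of the vectors of the frame. -/
def comb (x : X) (y : Q.Vertex) : (Fin (β y) → L) →ₗ[L] (Fin (α y) → L) :=
  Fintype.linearCombination L fun j i => E.vec y j i x

lemma comb_apply (x : X) (y : Q.Vertex) (u : Fin (β y) → L) (i : Fin (α y)) :
    E.comb x y u i = ∑ j, E.vec y j i x * u j := by
  simp [comb, Fintype.linearCombination_apply, mul_comm]

lemma range_comb (x : X) (y : Q.Vertex) : LinearMap.range (E.comb x y) = ((p x).1.1 y).1 := by
  rw [comb, Fintype.range_linearCombination, E.span_vec]

lemma isLinearForm_comb (y : Q.Vertex) (i : Fin (α y)) :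
    IsLinearForm A fun x u => E.comb x y u i := by
  simp only [comb_apply]
  exact .sum _ fun j => .smul (E.vec_mem _ _ _) (.coord j)

lemma isLinearForm_map (E : CoordinateFamily A p) (a : Q.Arrow) (i : Fin (α (Q.head a))) :
    IsLinearForm A fun x v => (p x).1.2 a v i := by
  have h : (fun x v => (p x).1.2 a v i) = fun x v => ∑ j, E.mat a i j x * v j :=
    funext fun x => funext fun v => E.map_apply x a v i
  rw [h]
  exact .sum _ fun j => .smul (E.mat_mem _ _ _) (.coord j)

lemma isPrimitive_mem (E : CoordinateFamily A p) (y : Q.Vertex) :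
    IsPrimitive A fun x (v : Fin (α y) → L) => v ∈ ((p x).1.1 y).1 := by
  have : IsPrimitive A fun x (v : Fin (α y) ⊕ Fin (β y) → L) =>
      ∀ i, E.comb x y (v ∘ Sum.inr) i - v (Sum.inl i) = 0 :=
    .all fun i => .eq_zero (((E.isLinearForm_comb y i).comp_reindex _).sub (.coord _))
  refine this.ex.congr fun x v => ?_
  rw [← E.range_comb]
  simp only [sub_eq_zero, LinearMap.mem_range, funext_iff]
  rfl

/-- The presentation of the family of subrepresentations. -/
def subRep (E : CoordinateFamily A p) : QuiverRep.Presentation A fun x => (p x).subRep where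
  gen y := Fin (β y)
  proj x y := (E.comb x y).codRestrict ((p x).1.1 y).1
    fun u => E.range_comb x y ▸ LinearMap.mem_range_self _ u
  proj_surjective x y := by
    rintro ⟨w, hw⟩
    have hw' := hw
    change w ∈ ((p x).1.1 y).1 at hw'
    rw [← E.range_comb] at hw'
    obtain ⟨u, rfl⟩ := hw'
    exact ⟨u, rfl⟩
  ker y := (IsPrimitive.all fun i => .eq_zero (E.isLinearForm_comb y i)).congr
    fun x v => Subtype.ext_iff.trans funext_iff
  graph a := by
    have : IsPrimitive A fun x (v : Fin (β (Q.tail a)) ⊕ Fin (β (Q.head a)) → L) =>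
        ∀ i, (p x).1.2 a (fun k => E.comb x _ (v ∘ Sum.inl) k) i -
          E.comb x _ (v ∘ Sum.inr) i = 0 :=
      .all fun i => .eq_zero (((E.isLinearForm_map a i).comp
        fun k => (E.isLinearForm_comb _ k).comp_reindex _).sub
          ((E.isLinearForm_comb _ i).comp_reindex _))
    refine this.congr fun x v => ?_
    simp only [sub_eq_zero]
    exact Subtype.ext_iff.trans funext_iff

/-- The presentation of the family of quotient representations. -/
def quotRep (E : CoordinateFamily A p) : QuiverRep.Presentation A fun x => (p x).quotRep where
  gen y := Fin (α y)
  proj x y := ((p x).1.1 y).1.mkQ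
  proj_surjective x y := Submodule.mkQ_surjective _
  ker y := (E.isPrimitive_mem y).congr fun x v => Submodule.Quotient.mk_eq_zero _
  graph a := by
    -- Equality of classes in the quotient means that the difference lies in the subspace at the
    -- head.
    have := (E.isPrimitive_mem (Q.head a)).comp (ι := Fin (α (Q.tail a)) ⊕ Fin (α (Q.head a)))
      fun i => ((E.isLinearForm_map a i).comp_reindex Sum.inl).sub (.coord (Sum.inr i))
    exact this.congr fun x v => Submodule.Quotient.eq _

lemma finitelyMeasurable (E : CoordinateFamily A p) {C : BooleanSubalgebra (Set X)} (hAC : ∀ a ∈ A, {x | a x = 0} ∈ C)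
    {s : SubrepBundle L Q α β → ℕ} (hs : IsInducedRankFunction s) :
    FinitelyMeasurable C fun x => s (p x) := by
  obtain ⟨r, hr, rfl | rfl⟩ := hs
  · exact hr.finitelyMeasurable hAC E.subRep
  · exact hr.finitelyMeasurable hAC E.quotRep

lemma preimage_mem (E : CoordinateFamily A p) {C : BooleanSubalgebra (Set X)} (hAC : ∀ a ∈ A, {x | a x = 0} ∈ C)
    {S : Set (SubrepBundle L Q α β)} (hS : IsRankLocus S) : p ⁻¹' S ∈ C := by
  obtain ⟨n, m, m', s, M, b, M', b', hs, rfl⟩ := hS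
  exact FinitelyMeasurable.setOf_mem (fun i => E.finitelyMeasurable hAC (hs i))
    fun k => (∀ j, ∑ i, M j i * (k i : ℝ) ≤ b j) ∧ ∀ j, ∑ i, M' j i * (k i : ℝ) < b' j

end CoordinateFamily

end SubrepBundle

/-! ### Normal frames of subspaces and Cramer's rule -/

section NormalForm

variable {L : Type v} [Field L]

/-- The rows of `F` at the columns selected by `I` form the identity matrix, and the rows of `F`
span `W`. -/
structure IsNormalFrame {m n : Type*} [Fintype m] [DecidableEq m] (I : m → n)
    (W : Submodule L (n → L)) (F : Matrix m n L) : Prop where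
  span_eq : Submodule.span L (Set.range F.row) = W
  submatrix_eq : F.submatrix id I = 1

variable {m n : Type*} [Fintype m] [DecidableEq m] {I : m → n} {F G : Matrix m n L}

/-- The rows of `G` are combinations of those of `F`, and the coefficients can be read off in the
columns `I`, where `F` is the identity. -/
lemma IsNormalFrame.submatrix_mul (hF : IsNormalFrame I (Submodule.span L (Set.range G.row)) F) :
    G.submatrix id I * F = G := by
  have hG : ∀ j, ∃ c : m → L, Matrix.vecMul c F = G.row j := by
    intro j
    have : G.row j ∈ Submodule.span L (Set.range F.row) :=
      hF.span_eq ▸ Submodule.subset_span ⟨j, rfl⟩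
    obtain ⟨c, hc⟩ := (Submodule.mem_span_range_iff_exists_fun L).1 this
    exact ⟨c, by rw [Matrix.vecMul_eq_sum]; exact hc⟩
  choose c hc using hG
  have hG : Matrix.of c * F = G := by
    ext j i
    exact congrFun (hc j) i
  have : G.submatrix id I = Matrix.of c := by
    calc G.submatrix id I = (Matrix.of c * F).submatrix id I := by rw [hG]
      _ = Matrix.of c * F.submatrix id I := rfl
      _ = Matrix.of c := by rw [hF.submatrix_eq, Matrix.mul_one]
  rw [this, hG]

lemma IsNormalFrame.det_ne_zero (hF : IsNormalFrame I (Submodule.span L (Set.range G.row)) F)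
    (hG : LinearIndependent L G.row) : (G.submatrix id I).det ≠ 0 := by
  intro h
  obtain ⟨v, hv0, hv⟩ := Matrix.exists_vecMul_eq_zero_iff.2 h
  refine hv0 (funext fun j => Fintype.linearIndependent_iff.1 hG v ?_ j)
  change ∑ j, v j • G j = 0
  rw [← Matrix.vecMul_eq_sum, ← hF.submatrix_mul, ← Matrix.vecMul_vecMul, hv, Matrix.zero_vecMul]

/-- This clears the denominator in `F = G_I⁻¹ G`: the left side is polynomial in the entries of `G`.
-/
lemma IsNormalFrame.adjugate_mul (hF : IsNormalFrame I (Submodule.span L (Set.range G.row)) F) :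
    (G.submatrix id I).adjugate * G = (G.submatrix id I).det • F := by
  have h : (G.submatrix id I).adjugate * (G.submatrix id I * F) =
      (G.submatrix id I).adjugate * G := congrArg _ hF.submatrix_mul
  rw [← h, ← Matrix.mul_assoc, Matrix.adjugate_mul, Matrix.smul_mul, Matrix.one_mul]

lemma exists_isNormalFrame (h : (G.submatrix id I).det ≠ 0) :
    ∃ F, IsNormalFrame I (Submodule.span L (Set.range G.row)) F := by
  have hu : IsUnit (G.submatrix id I).det := isUnit_iff_ne_zero.2 h
  have hle : ∀ (T : Matrix m m L) (H : Matrix m n L),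
      Submodule.span L (Set.range (T * H).row) ≤ Submodule.span L (Set.range H.row) := by
    intro T H
    rw [Submodule.span_le]
    rintro _ ⟨j, rfl⟩
    have : (T * H).row j = ∑ k, T j k • H k := by
      rw [← Matrix.vecMul_eq_sum]
      rfl
    rw [this]
    exact Submodule.sum_mem _ fun k _ => Submodule.smul_mem _ _ (Submodule.subset_span ⟨k, rfl⟩)
  refine ⟨(G.submatrix id I)⁻¹ * G, le_antisymm (hle _ _) ?_, ?_⟩
  · have := hle (G.submatrix id I) ((G.submatrix id I)⁻¹ * G)
    rwa [← Matrix.mul_assoc, Matrix.mul_nonsing_inv _ hu, Matrix.one_mul] at this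
  · exact Matrix.nonsing_inv_mul _ hu

lemma exists_det_submatrix_ne_zero {b : ℕ} {n : Type*} [Fintype n] {G : Matrix (Fin b) n L}
    (hG : LinearIndependent L G.row) : ∃ I : Fin b → n, (G.submatrix id I).det ≠ 0 := by
  have h := hG.rank_matrix
  rw [← Matrix.rank_transpose, Fintype.card_fin] at h
  obtain ⟨I, hI⟩ := Matrix.exists_linearIndependent_row_submatrix _ h.ge
  refine ⟨I, ?_⟩
  rw [← Matrix.det_transpose]
  exact ((Matrix.isUnit_iff_isUnit_det _).1
    (Matrix.linearIndependent_rows_iff_isUnit.1 hI)).ne_zero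

end NormalForm

/-! ### Noetherianity of the Zariski topologies -/

section Zariski

open TopologicalSpace Topology

variable (K : Type u) (L : Type v) [Field K] [Field L] [Algebra K L]

lemma isClosed_zariskiTopology_iff {ι : Type} {Z : Set (ι → L)} :
    IsClosed[zariskiTopology K L ι] Z ↔
      ∃ P : Set (MvPolynomial ι K), Z = {x | ∀ p ∈ P, MvPolynomial.aeval x p = 0} := by
  rw [← @isOpen_compl_iff _ _ (zariskiTopology K L ι)]
  change Zᶜᶜ ∈ _ ↔ _
  rw [compl_compl]
  rfl

/-- A closed set is recovered from its ideal of vanishing polynomials over `K`, so descending chains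
of closed sets give ascending chains of ideals, and Hilbert's basis theorem applies. No
Nullstellensatz is involved. -/
lemma noetherianSpace_zariskiTopology (ι : Type) [Finite ι] :
    @NoetherianSpace (ι → L) (zariskiTopology K L ι) := by
  let := zariskiTopology K L ι
  let I : Closeds (ι → L) → Ideal (MvPolynomial ι K) := fun Z =>
    ⨅ x ∈ Z, RingHom.ker (MvPolynomial.aeval (R := K) x)
  have hI : ∀ Z p, p ∈ I Z ↔ ∀ x ∈ Z, MvPolynomial.aeval x p = 0 := fun Z p => by
    simp [I, Submodule.mem_iInf, RingHom.mem_ker]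
  have hle : ∀ Z Z', I Z ≤ I Z' → Z' ≤ Z := by
    intro Z Z' h x hx
    obtain ⟨P, hP⟩ := (isClosed_zariskiTopology_iff K L).1 Z.isClosed
    change x ∈ (Z : Set (ι → L))
    rw [hP]
    refine fun p hp => (hI Z' p).1 (h ((hI Z p).2 fun y hy => ?_)) x hx
    have hy' : y ∈ (Z : Set (ι → L)) := hy
    rw [hP] at hy'
    exact hy' p hp
  have hanti : StrictAnti I := by
    intro Z Z' h
    refine lt_of_le_not_ge (fun p hp => (hI _ _).2 fun x hx => (hI _ _).1 hp x (h.le hx)) ?_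
    exact fun h' => h.not_ge (hle _ _ h')
  exact ((noetherianSpace_TFAE (ι → L)).out 0 1).2 hanti.wellFoundedLT

variable {L} (Q : FinQuiver) (α β : Q.Vertex → ℕ)

lemma FramedRep.toGrRep_surjective :
    Function.Surjective (FramedRep.toGrRep (L := L) (Q := Q) (α := α) (β := β)) := by
  rintro ⟨W, φ⟩
  let b : ∀ y, Module.Basis (Fin (β y)) L (W y).1 := fun y =>
    Module.finBasisOfFinrankEq L (W y).1 (W y).2
  let c : FrameCoord Q α β → L := Sum.elim (fun s => (b s.1 s.2.2 : Fin (α s.1) → L) s.2.1)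
    fun s => LinearMap.toMatrix' (φ s.1) s.2.1 s.2.2
  have hframe : ∀ y, frame c y = Subtype.val ∘ b y := fun y => rfl
  refine ⟨⟨c, fun y => ?_⟩, Prod.ext (funext fun y => Subtype.ext ?_) (funext fun a => ?_)⟩
  · rw [hframe]
    exact (b y).linearIndependent.map' (W y).1.subtype (Submodule.ker_subtype _)
  · change Submodule.span L (Set.range (frame c y)) = _
    rw [hframe, Set.range_comp]
    change Submodule.span L ((W y).1.subtype '' _) = _
    rw [Submodule.span_image, (b y).span_eq, Submodule.map_top, Submodule.range_subtype]
  · exact Matrix.toLin'_toMatrix' (φ a)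

lemma noetherianSpace_grRepTopology :
    @NoetherianSpace (Gr L Q α β × RepSpace L Q α) (grRepTopology K L Q α β) := by
  let := zariskiTopology K L (FrameCoord Q α β)
  have := noetherianSpace_zariskiTopology K L (FrameCoord Q α β)
  let : TopologicalSpace (FramedRep L Q α β) :=
    TopologicalSpace.induced Subtype.val (zariskiTopology K L (FrameCoord Q α β))
  have : NoetherianSpace (FramedRep L Q α β) :=
    (IsInducing.mk rfl : IsInducing (Subtype.val : FramedRep L Q α β → _)).noetherianSpace
  let := grRepTopology K L Q α β
  exact noetherianSpace_of_surjective FramedRep.toGrRep continuous_coinduced_rng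
    (FramedRep.toGrRep_surjective Q α β)

lemma noetherianSpace_zariski :
    @NoetherianSpace (SubrepBundle L Q α β) (SubrepBundle.zariski K L Q α β) := by
  let := grRepTopology K L Q α β
  have := noetherianSpace_grRepTopology K (L := L) Q α β
  let := SubrepBundle.zariski K L Q α β
  exact (IsInducing.mk rfl : IsInducing (Subtype.val : SubrepBundle L Q α β → _)).noetherianSpace

variable {Q α β}

lemma isClosed_grRepTopology_of_preimage {Z : Set (Gr L Q α β × RepSpace L Q α)}
    {q : MvPolynomial (FrameCoord Q α β) K}
    (h : ∀ c : FramedRep L Q α β, c.toGrRep ∈ Z ↔ MvPolynomial.aeval c.1 q = 0) :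
    IsClosed[grRepTopology K L Q α β] Z := by
  rw [isClosed_coinduced, @isClosed_induced_iff _ _ (zariskiTopology K L (FrameCoord Q α β))]
  refine ⟨{x | MvPolynomial.aeval x q = 0},
    (isClosed_zariskiTopology_iff K L).2 ⟨{q}, by simp⟩, ?_⟩
  ext c
  exact (h c).symm

/-- `IsConstructible` is built from retrocompact open sets; in a Noetherian space every open set is
one, since all subsets are compact. -/
lemma isConstructible_of_isOpen {Y : Type*} [TopologicalSpace Y] [NoetherianSpace Y] {U : Set Y}
    (hU : IsOpen U) : IsConstructible U :=
  IsRetrocompact.isConstructible hU fun _ _ _ => NoetherianSpace.isCompact _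

end Zariski

/-! ### Standard charts and their regular functions -/

section Chart

open Topology

variable {L : Type v} [Field L] {Q : FinQuiver} {α β : Q.Vertex → ℕ}
  (I : ∀ y, Fin (β y) → Fin (α y))

/-- The subspaces with normal frames at the positions `I`. -/
def chart : Set (Gr L Q α β × RepSpace L Q α) :=
  {p | ∀ y, ∃ F, IsNormalFrame (I y) (p.1 y).1 F}

open Classical in
/-- The normal frame at the vertex `y` of a point of the chart. -/
noncomputable def normalFrame (p : Gr L Q α β × RepSpace L Q α) (y : Q.Vertex) :
    Matrix (Fin (β y)) (Fin (α y)) L :=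
  -- The value off the chart is arbitrary: `chartRing` constrains functions only on the chart.
  if h : p ∈ chart I then (h y).choose else 0

variable {I}

lemma isNormalFrame_normalFrame {p : Gr L Q α β × RepSpace L Q α} (h : p ∈ chart I)
    (y : Q.Vertex) : IsNormalFrame (I y) (p.1 y).1 (normalFrame I p y) := by
  rw [normalFrame, dif_pos h]
  exact (h y).choose_spec

variable (I)

/-- The frame at a vertex as a matrix. -/
def FramedRep.mat (c : FramedRep L Q α β) (y : Q.Vertex) : Matrix (Fin (β y)) (Fin (α y)) L :=
  frame c.1 y

lemma FramedRep.toGrRep_mem_chart_iff (c : FramedRep L Q α β) :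
    c.toGrRep ∈ chart I ↔ ∀ y, ((c.mat y).submatrix id (I y)).det ≠ 0 :=
  forall_congr' fun y => ⟨fun ⟨_, hF⟩ => IsNormalFrame.det_ne_zero (G := c.mat y) hF (c.2 y),
    fun h => exists_isNormalFrame h⟩

lemma exists_mem_chart (p : Gr L Q α β × RepSpace L Q α) :
    ∃ I : ∀ y, Fin (β y) → Fin (α y), p ∈ chart I := by
  obtain ⟨c, rfl⟩ := FramedRep.toGrRep_surjective Q α β p
  choose I hI using fun y => exists_det_submatrix_ne_zero (G := c.mat y) (c.2 y)
  exact ⟨I, (c.toGrRep_mem_chart_iff I).2 hI⟩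

variable (K : Type u) [Field K] [Algebra K L]

/-- The frame with indeterminate entries. -/
noncomputable def genericFrame (α β : Q.Vertex → ℕ) (y : Q.Vertex) :
    Matrix (Fin (β y)) (Fin (α y)) (MvPolynomial (FrameCoord Q α β) K) :=
  Matrix.of fun j i => MvPolynomial.X (Sum.inl ⟨y, i, j⟩)

variable {K} in
lemma map_genericFrame (c : FramedRep L Q α β) (y : Q.Vertex) :
    (genericFrame K α β y).map (MvPolynomial.aeval c.1) = c.mat y := by
  ext j i
  simp [genericFrame, FramedRep.mat, frame]

/-- The minor of the generic frame at the positions `I`. -/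
noncomputable def genericMinor (y : Q.Vertex) : MvPolynomial (FrameCoord Q α β) K :=
  ((genericFrame K α β y).submatrix id (I y)).det

lemma aeval_genericMinor (c : FramedRep L Q α β) (y : Q.Vertex) :
    MvPolynomial.aeval c.1 (genericMinor I K y) = ((c.mat y).submatrix id (I y)).det := by
  rw [genericMinor, AlgHom.map_det, ← map_genericFrame (K := K)]
  rfl

lemma toGrRep_mem_chart_iff_aeval (c : FramedRep L Q α β) :
    c.toGrRep ∈ chart I ↔ MvPolynomial.aeval c.1 (∏ y, genericMinor I K y) ≠ 0 := by
  simp only [c.toGrRep_mem_chart_iff, map_prod, aeval_genericMinor, Finset.prod_ne_zero_iff,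
    Finset.mem_univ, true_imp_iff]

/-- The functions that are regular on the chart, that is, quotients of polynomials in the
coordinates of frames and representations. -/
noncomputable def chartRing : Subring (Gr L Q α β × RepSpace L Q α → L) where
  -- The polynomials `p` and `q` may depend on the frame; only their quotient has to descend to the
  -- subspaces.
  carrier := {a | ∃ p q : MvPolynomial (FrameCoord Q α β) K, ∀ c : FramedRep L Q α β,
    c.toGrRep ∈ chart I → MvPolynomial.aeval c.1 q ≠ 0 ∧
      MvPolynomial.aeval c.1 p = MvPolynomial.aeval c.1 q * a c.toGrRep}
  mul_mem' := by
    rintro a a' ⟨p, q, h⟩ ⟨p', q', h'⟩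
    refine ⟨p * p', q * q', fun c hc => ?_⟩
    obtain ⟨h1, h2⟩ := h c hc
    obtain ⟨h3, h4⟩ := h' c hc
    simp only [map_mul, Pi.mul_apply, h2, h4]
    exact ⟨mul_ne_zero h1 h3, by ring⟩
  one_mem' := ⟨1, 1, by simp⟩
  add_mem' := by
    rintro a a' ⟨p, q, h⟩ ⟨p', q', h'⟩
    refine ⟨p * q' + p' * q, q * q', fun c hc => ?_⟩
    obtain ⟨h1, h2⟩ := h c hc
    obtain ⟨h3, h4⟩ := h' c hc
    simp only [map_mul, map_add, Pi.add_apply, h2, h4]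
    exact ⟨mul_ne_zero h1 h3, by ring⟩
  zero_mem' := ⟨0, 1, by simp⟩
  neg_mem' := by
    rintro a ⟨p, q, h⟩
    refine ⟨-p, q, fun c hc => ?_⟩
    obtain ⟨h1, h2⟩ := h c hc
    simp [h1, h2]

lemma normalFrame_mem_chartRing (y : Q.Vertex) (j : Fin (β y)) (i : Fin (α y)) :
    (fun p => normalFrame I p y j i) ∈ chartRing (L := L) I K := by
  refine ⟨(((genericFrame K α β y).submatrix id (I y)).adjugate * genericFrame K α β y) j i,
    genericMinor I K y, fun c hc => ?_⟩
  have h := (isNormalFrame_normalFrame hc y).adjugate_mul (G := c.mat y)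
  rw [aeval_genericMinor]
  refine ⟨(c.toGrRep_mem_chart_iff I).1 hc y, ?_⟩
  have h' := congrFun (congrFun h j) i
  rw [Matrix.smul_apply, smul_eq_mul] at h'
  rw [← h', ← map_genericFrame (K := K)]
  have hadj := AlgHom.map_adjugate (MvPolynomial.aeval (R := K) c.1)
    ((genericFrame K α β y).submatrix id (I y))
  rw [AlgHom.mapMatrix_apply, AlgHom.mapMatrix_apply] at hadj
  rw [Matrix.submatrix_map, ← hadj, ← Matrix.map_mul]
  rfl

lemma toMatrix_mem_chartRing (a : Q.Arrow) (i : Fin (α (Q.head a))) (j : Fin (α (Q.tail a))) :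
    (fun p => LinearMap.toMatrix' (p.2 a) i j) ∈ chartRing (L := L) (β := β) I K := by
  refine ⟨MvPolynomial.X (Sum.inr ⟨a, i, j⟩), 1, fun c _ => ⟨by simp, ?_⟩⟩
  simp [FramedRep.toGrRep]

variable {I K}

/-- On frames this set is the zero set of the numerator times the chart minors: the minors account
for the complement of the chart, and on the chart the denominator is nonzero. -/
lemma isClosed_setOf_mem_chart_imp {a : Gr L Q α β × RepSpace L Q α → L}
    (ha : a ∈ chartRing I K) :
    IsClosed[grRepTopology K L Q α β] {p | p ∈ chart I → a p = 0} := by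
  obtain ⟨p, q, h⟩ := ha
  refine isClosed_grRepTopology_of_preimage K (q := p * ∏ y, genericMinor I K y) fun c => ?_
  rw [map_mul, mul_eq_zero, ← not_ne_iff (a := MvPolynomial.aeval c.1 (∏ y, genericMinor I K y)),
    ← toGrRep_mem_chart_iff_aeval]
  change (_ → _) ↔ _
  by_cases hc : c.toGrRep ∈ chart I
  · simp [hc, (h c hc).2, (h c hc).1]
  · simp [hc]

variable (K) in
lemma isOpen_chart : IsOpen[grRepTopology K L Q α β] (chart I) := by
  let := grRepTopology K L Q α β
  -- For the constant function `1` the closed set is the complement of the chart.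
  have := isClosed_setOf_mem_chart_imp (chartRing (L := L) I K).one_mem
  rw [← isClosed_compl_iff]
  convert this using 1
  ext p
  simp

end Chart

/-! ### Gluing over the charts of the bundle -/

section Bundle

open TopologicalSpace Topology

/-- The sets in a constructible subspace that are constructible in the whole space. -/
def constructibleSubalgebra {Y : Type*} [TopologicalSpace Y] {U : Set Y} (hU : IsConstructible U) :
    BooleanSubalgebra (Set U) where
  carrier := {T | IsConstructible (Subtype.val '' T)}
  supClosed' := fun S hS T hT => by
    change IsConstructible (Subtype.val '' (S ∪ T))
    rw [Set.image_union]
    exact IsConstructible.union hS hT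
  infClosed' := fun S hS T hT => by
    change IsConstructible (Subtype.val '' (S ∩ T))
    rw [Set.image_inter Subtype.val_injective]
    exact IsConstructible.inter hS hT
  compl_mem' := fun {T} hT => by
    change IsConstructible (Subtype.val '' Tᶜ)
    -- The complement is taken inside `U`, which is why `U` itself must be constructible.
    rw [Set.image_compl_eq_range_sdiff_image Subtype.val_injective, Subtype.range_coe]
    exact hU.sdiff hT
  bot_mem' := by
    change IsConstructible (Subtype.val '' ∅)
    rw [Set.image_empty]
    exact .empty

variable {L : Type v} [Field L] {Q : FinQuiver} {α β : Q.Vertex → ℕ}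
  (I : ∀ y, Fin (β y) → Fin (α y)) (K : Type u) [Field K] [Algebra K L]

/-- The part of the bundle over a chart. -/
def bundleChart : Set (SubrepBundle L Q α β) := {p | p.1 ∈ chart I}

/-- The restrictions of the regular functions on a chart to the bundle. -/
noncomputable def bundleChartRing : Subring (bundleChart (L := L) I → L) :=
  (chartRing I K).map
    (RingHom.pi fun p : bundleChart (L := L) I => Pi.evalRingHom (fun _ => L) p.1.1)

variable {K} in
lemma comp_mem_bundleChartRing {a : Gr L Q α β × RepSpace L Q α → L} (ha : a ∈ chartRing I K) :
    (fun p : bundleChart (L := L) I => a p.1.1) ∈ bundleChartRing I K :=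
  ⟨a, ha, rfl⟩

/-- The tautological coordinates over a chart. -/
noncomputable def bundleChartCoordinates :
    SubrepBundle.CoordinateFamily (bundleChartRing (L := L) I K)
      (Subtype.val : bundleChart (L := L) I → SubrepBundle L Q α β) where
  vec y j i p := normalFrame I p.1.1 y j i
  vec_mem y j i := comp_mem_bundleChartRing I (normalFrame_mem_chartRing I K y j i)
  span_vec p y := (isNormalFrame_normalFrame p.2 y).span_eq
  mat a i j p := LinearMap.toMatrix' (p.1.1.2 a) i j
  mat_mem a i j := comp_mem_bundleChartRing I (toMatrix_mem_chartRing I K a i j)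
  map_apply p a v i := congrFun (LinearMap.toMatrix'_mulVec (p.1.1.2 a) v).symm i

lemma isConstructible_bundleChart :
    @IsConstructible _ (SubrepBundle.zariski K L Q α β) (bundleChart (L := L) I) := by
  let := grRepTopology K L Q α β
  let := SubrepBundle.zariski K L Q α β
  have := noetherianSpace_zariski K (L := L) Q α β
  exact isConstructible_of_isOpen ((isOpen_chart K).preimage continuous_induced_dom)

lemma isConstructible_image_setOf_eq_zero {a : bundleChart (L := L) I → L}
    (ha : a ∈ bundleChartRing I K) :
    @IsConstructible _ (SubrepBundle.zariski K L Q α β) (Subtype.val '' {p | a p = 0}) := by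
  obtain ⟨b, hb, rfl⟩ := ha
  let := grRepTopology K L Q α β
  let := SubrepBundle.zariski K L Q α β
  have := noetherianSpace_zariski K (L := L) Q α β
  have hcl : IsClosed {p : SubrepBundle L Q α β | p.1 ∈ chart I → b p.1 = 0} :=
    (isClosed_setOf_mem_chart_imp hb).preimage continuous_induced_dom
  have := (isConstructible_bundleChart I K).inter
    (isConstructible_compl.1 (isConstructible_of_isOpen hcl.isOpen_compl))
  convert this using 1
  ext p
  constructor
  · rintro ⟨p, hp, rfl⟩
    exact ⟨p.2, fun _ => hp⟩
  · rintro ⟨hp, h⟩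
    exact ⟨⟨p, hp⟩, h hp, rfl⟩

end Bundle

theorem theorem4p1 {K : Type u} {L : Type v} [Field K] [Field L] [Algebra K L]
    (Q : FinQuiver) (α β : Q.Vertex → ℕ)
    (S : Set (SubrepBundle L Q α β)) (hS : SubrepBundle.IsRankLocus S) :
    @Topology.IsConstructible (SubrepBundle L Q α β) (SubrepBundle.zariski K L Q α β) S := by
  let := SubrepBundle.zariski K L Q α β
  -- There are finitely many position choices `I`, and their charts cover the bundle, so
  -- constructibility may be checked on each piece.
  have h : S = ⋃ I : ∀ y, Fin (β y) → Fin (α y),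
      Subtype.val '' (Subtype.val ⁻¹' S : Set (bundleChart (L := L) I)) := by
    ext p
    simp only [Subtype.image_preimage_coe, Set.mem_iUnion, Set.mem_inter_iff]
    constructor
    · intro hp
      obtain ⟨I, hI⟩ := exists_mem_chart p.1
      exact ⟨I, hI, hp⟩
    · exact fun ⟨_, _, hp⟩ => hp
  rw [h]
  exact Topology.IsConstructible.iUnion fun I =>
    (bundleChartCoordinates I K).preimage_mem
      (C := constructibleSubalgebra (isConstructible_bundleChart I K))
      (fun a ha => isConstructible_image_setOf_eq_zero I K ha) hS
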